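/- A Maya diagram is a set $M\subset\mathbb Z$ containing finitely many non-negative integers and omitting finitely many negative ones. Write $M=(n_1',\dots,n_q'\,|\,n_1,\dots,n_p)$, where $n_1>\dots>n_p\ge0$ are the non-negative elements of $M$ and $n_1'>\dots>n_q'\ge0$ are the numbers $-k-1$ for the negative integers $k\notin M$. For $t\in\mathbb Z$ let $M+t=\{k+t:k\in M\}$. $M$ is in canonical position if it contains all negative integers and $0\notin M$; for every $M$ there is exactly one $t$ such that $M+t$ is in canonical position. A diagram $(\emptyset\,|\,n_1,\dots,n_p)$ in canonical position is identified with the partition $(\mu_1,\dots,\mu_p)$, $\mu_j=n_j-p+j$. For $\alpha\in\mathbb R$, $\lambda\in\mathbb C$, $x>0$ let $L_n^\alpha$ be the generalized Laguerre polynomials and let $h^\alpha(x,\lambda)=M(-\lambda,\alpha+1,x)={}_1F_1(-\lambda;\alpha+1;x)$ be Kummer's function (for $\alpha+1\notin\{0,-1,-2,\dots\}$). For Maya diagrams $M_1=(n_1',\dots,n_{r_4}'\,|\,n_1,\dots,n_{r_1})$ and $M_2=(m_1',\dots,m_{r_3}'\,|\,m_1,\dots,m_{r_2})$ let $f_1,\dots,f_r$,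 $r=r_1+r_2+r_3+r_4$, be the functions $$L_{n_j}^{\alpha}(x)\ (1\le j\le r_1),\quad e^xL_{m_j}^{\alpha}(-x)\ (1\le j\le r_2),\quad x^{-\alpha}L_{m_j'}^{-\alpha}(x)\ (1\le j\le r_3),\quad e^xx^{-\alpha}L_{n_j'}^{-\alpha}(-x)\ (1\le j\le r_4),$$ in this order, and put $$\Omega_{M_1,M_2}[h^\alpha(x,\lambda)]=e^{-(r_2+r_4)x}x^{(\alpha+r_1+r_2+1)(r_3+r_4)}\,\mathrm{Wr}[f_1,\dots,f_r,h^\alpha(\cdot,\lambda)](x).$$ If $\mu$ and $\nu$ are the partitions of two diagrams $N_1,N_2$ in canonical position, write $\Omega_{\mu,\nu}=\Omega_{N_1,N_2}$. Let $z^{(n)}=z(z+1)\cdots(z+n-1)$ and $z_{(n)}=z(z-1)\cdots(z-n+1)$. **Theorem.** Let $t_1,t_2\in\mathbb Z$ be the shifts for which $M_1+t_1$ and $M_2+t_2$ are in canonical position, and let $\mu,\nu$ be the partitions of $M_1+t_1$ and $M_2+t_2$. There is a sign $\varepsilon\in\{1,-1\}$ depending only on $M_1$ and $M_2$ such that, for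 all $x>0$ and all $\alpha\in\mathbb R$, $\lambda\in\mathbb C$ for which neither $\alpha+1$ nor $\alpha-t_1-t_2+1$ is a non-positive integer, $\lambda\ne n_i$ for $i=1,\dots,r_1$, and the denominators in $C_1$ and $C_2$ below are non-zero, $$\Omega_{M_1,M_2}[h^{\alpha}(x,\lambda)]=\varepsilon\,C_1\,C_2\,C_3\;\Omega_{\mu,\nu}[h^{\alpha-t_1-t_2}(x,\lambda+t_1)],$$ where $$C_1=\begin{cases}\dfrac{(-\lambda)^{(|t_1|)}}{(\alpha+1)^{(|t_1|)}},&t_1<0,\\[2mm]1,&t_1=0,\\[1mm]\dfrac{(\alpha)_{(t_1)}}{\prod_{k_1}(-\lambda-k_1-1)},&t_1>0,\end{cases}\qquad C_2=\begin{cases}\dfrac{(\alpha+1+\lambda)^{(|t_2|)}}{(\alpha-t_1+1)^{(|t_2|)}},&t_2<0,\\[2mm]1,&t_2=0,\\[1mm]\dfrac{\prod_{k_2}(\alpha-t_1-k_2)\,\prod_{i=1}^{r_3}(\alpha-t_1-m_i')}{\prod_{k_2}(\lambda+\alpha-k_2)},&t_2>0,\end{cases}$$ with $k_1$ running through $\{0,\dots,t_1-1\}\setminus\{n_j'\}_{j=1}^{r_4}$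 and $k_2$ through $\{0,\dots,t_2-1\}\setminus\{m_j'\}_{j=1}^{r_3}$, and $$C_3=\prod_{j=1}^{r_1}\prod_{k=1}^{r_3}(m_k'-\alpha-n_j)\prod_{j=1}^{r_2}\prod_{k=1}^{r_4}(n_k'-\alpha-m_j)\prod_{j=1}^{r_1}\prod_{k=1}^{r_4}(n_j+n_k'+1)\prod_{j=1}^{r_2}\prod_{k=1}^{r_3}(m_j+m_k'+1).$$ -/

import Mathlib

/-- A Maya diagram: a set of integers which contains only finitely many nonnegative integers and
misses only finitely many negative integers. -/
structure MayaDiagram where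
  /-- the filled boxes -/
  carrier : Set ℤ
  finite_filled : {k : ℤ | k ∈ carrier ∧ 0 ≤ k}.Finite
  finite_empty : {k : ℤ | k ∉ carrier ∧ k < 0}.Finite

namespace MayaDiagram

/-- The translate `M + t = {k + t | k ∈ M}`. -/
def shift (M : MayaDiagram) (t : ℤ) : MayaDiagram where
  carrier := {k | k - t ∈ M.carrier}
  finite_filled := by
    refine ((M.finite_filled.union (Set.finite_Icc (-t) 0)).image (fun k => k + t)).subset ?_
    rintro k ⟨hk, hk0⟩
    refine ⟨k - t, ?_, by simp⟩
    by_cases h : 0 ≤ k - t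
    · exact Or.inl ⟨hk, h⟩
    · exact Or.inr ⟨by omega, by omega⟩
  finite_empty := by
    refine ((M.finite_empty.union (Set.finite_Icc 0 (-t))).image (fun k => k + t)).subset ?_
    rintro k ⟨hk, hk0⟩
    refine ⟨k - t, ?_, by simp⟩
    by_cases h : k - t < 0
    · exact Or.inl ⟨hk, h⟩
    · exact Or.inr ⟨by omega, by omega⟩

/-- Canonical position: no empty box to the left of the origin, and the first box to the right of
the origin is empty. -/
def IsCanonical (M : MayaDiagram) : Prop :=
  (∀ k : ℤ, k < 0 → k ∈ M.carrier) ∧ (0 : ℤ) ∉ M.carrier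

theorem finite_right (M : MayaDiagram) : {n : ℕ | (n : ℤ) ∈ M.carrier}.Finite := by
  refine Set.Finite.of_finite_image (f := fun n : ℕ => (n : ℤ)) (M.finite_filled.subset ?_)
    (fun a _ b _ h => by simpa using h)
  rintro _ ⟨n, hn, rfl⟩
  exact ⟨hn, by simp⟩

theorem finite_left (M : MayaDiagram) : {n : ℕ | -(n : ℤ) - 1 ∉ M.carrier}.Finite := by
  refine Set.Finite.of_finite_image (f := fun n : ℕ => -(n : ℤ) - 1) (M.finite_empty.subset ?_)
    (fun a _ b _ h => by simpa using h)
  rintro _ ⟨n, hn, rfl⟩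
  exact ⟨hn, by simp only; omega⟩

/-- The nonnegative elements `n₁ > n₂ > ⋯ ≥ 0` of `M`, as a set. -/
noncomputable def rightSet (M : MayaDiagram) : Finset ℕ := M.finite_right.toFinset

/-- The numbers `n' = -k - 1`, where `k` runs through the negative integers missing from `M`,
as a set. -/
noncomputable def leftSet (M : MayaDiagram) : Finset ℕ := M.finite_left.toFinset

/-- The decreasing list `n₁ > n₂ > ⋯`, the second half of the encoding `(n' | n)` of `M`. -/
noncomputable def right (M : MayaDiagram) : List ℕ := M.rightSet.sort (fun a b => b ≤ a)

/-- The decreasing list `n₁' > n₂' > ⋯`, the first half of the encoding `(n' | n)` of `M`. -/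
noncomputable def left (M : MayaDiagram) : List ℕ := M.leftSet.sort (fun a b => b ≤ a)

/-- The partition `μ_j = n_j - r + j` (`j = 1, …, r`) read off from `n₁ > ⋯ > n_r`; it is used for
diagrams in canonical position. The subtraction does not truncate, because `n_j ≥ r - j`. -/
noncomputable def partition (M : MayaDiagram) : List ℕ :=
  M.right.mapIdx fun i n => n + (i + 1) - M.right.length

end MayaDiagram

/-- The degrees `n_j = μ_j + r - j` (`j = 1, …, r`) of a partition `μ = (μ₁, …, μ_r)`. -/
def partitionDegrees (μ : List ℕ) : List ℕ :=
  μ.mapIdx fun i p => p + μ.length - (i + 1)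

/-- The rising factorial `z (z + 1) ⋯ (z + n - 1)`. -/
noncomputable def rising (z : ℂ) (n : ℕ) : ℂ := (ascPochhammer ℂ n).eval z

/-- The falling factorial `z (z - 1) ⋯ (z - n + 1)`. -/
noncomputable def falling (z : ℂ) (n : ℕ) : ℂ := (descPochhammer ℂ n).eval z

/-- The generalized Laguerre polynomial
`L_n^a(x) = ∑_{k=0}^n (-1)^k binom(n + a, n - k) x^k / k!`, where
`binom(n + a, n - k) = (a + k + 1) ⋯ (a + n) / (n - k)!`. -/
noncomputable def laguerreL (n : ℕ) (a x : ℝ) : ℝ :=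
  ∑ k ∈ Finset.range (n + 1),
    (-1) ^ k * ((ascPochhammer ℝ (n - k)).eval (a + k + 1) / ((n - k).factorial : ℝ))
      * (x ^ k / (k.factorial : ℝ))

/-- Kummer's confluent hypergeometric function `M(a, b, x) = ₁F₁(a; b; x)`. -/
noncomputable def kummerM (a b x : ℂ) : ℂ :=
  ∑' k : ℕ, rising a k / rising b k * (x ^ k / (k.factorial : ℂ))

/-- The solution `h^α(x, lam) = M(-lam, α + 1, x)` of the Laguerre equation. -/
noncomputable def hFirst (α : ℝ) (lam : ℂ) (x : ℝ) : ℂ := kummerM (-lam) ((α : ℂ) + 1) (x : ℂ)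

/-- The Wronskian determinant of a list of functions of a real variable. -/
noncomputable def wronskianDet (fs : List (ℝ → ℂ)) (x : ℝ) : ℂ :=
  Matrix.det (Matrix.of fun i j : Fin fs.length => iteratedDeriv (i : ℕ) (fs.get j) x)

/-- The seed functions `L_{n_j}^α(x)`, `e^x L_{m_j}^α(-x)`, `x^{-α} L_{m_j'}^{-α}(x)`,
`e^x x^{-α} L_{n_j'}^{-α}(-x)`, in this order. -/
noncomputable def seedFunctions (α : ℝ) (n m m' n' : List ℕ) : List (ℝ → ℂ) :=
  n.map (fun k x => ((laguerreL k α x : ℝ) : ℂ))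
    ++ m.map (fun k x => ((Real.exp x * laguerreL k α (-x) : ℝ) : ℂ))
    ++ m'.map (fun k x => ((x ^ (-α) * laguerreL k (-α) x : ℝ) : ℂ))
    ++ n'.map (fun k x => ((Real.exp x * x ^ (-α) * laguerreL k (-α) (-x) : ℝ) : ℂ))

/-- With `r₁, r₂, r₃, r₄` the lengths of `n, m, m', n'`, the function
`e^{-(r₂ + r₄) x} x^{(α + r₁ + r₂ + 1)(r₃ + r₄)} Wr[f₁, …, f_r, h^α(·, lam)](x)`. -/
noncomputable def omegaFirst (n m m' n' : List ℕ) (α : ℝ) (lam : ℂ) (x : ℝ) : ℂ :=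
  ((Real.exp (-((m.length : ℝ) + n'.length) * x)
      * x ^ ((α + n.length + m.length + 1) * ((m'.length : ℝ) + n'.length)) : ℝ) : ℂ)
    * wronskianDet (seedFunctions α n m m' n' ++ [hFirst α lam]) x

/-- The solution of the first kind `Ω_{M₁,M₂}[h^α(x, lam)]`, for
`M₁ = (n' | n)` and `M₂ = (m' | m)`. -/
noncomputable def omegaMaya (M₁ M₂ : MayaDiagram) (α : ℝ) (lam : ℂ) (x : ℝ) : ℂ :=
  omegaFirst M₁.right M₂.right M₂.left M₁.left α lam x

/-- The solution of the first kind `Ω_{μ,ν}[h^α(x, lam)]` attached to two partitions, that is, to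
the diagrams `(∅ | n)` and `(∅ | m)` with `n_j = μ_j + r(μ) - j` and `m_j = ν_j + r(ν) - j`. -/
noncomputable def omegaPartition (μ ν : List ℕ) (α : ℝ) (lam : ℂ) (x : ℝ) : ℂ :=
  omegaFirst (partitionDegrees μ) (partitionDegrees ν) [] [] α lam x

/-- The constant produced by the shift of `M₁` by `t₁`. -/
noncomputable def constC₁ (α : ℝ) (lam : ℂ) (M₁ : MayaDiagram) (t₁ : ℤ) : ℂ :=
  if t₁ < 0 then rising (-lam) t₁.natAbs / rising ((α : ℂ) + 1) t₁.natAbs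
  else if t₁ = 0 then 1
  else falling (α : ℂ) t₁.natAbs /
    ∏ k ∈ Finset.range t₁.natAbs \ M₁.leftSet, (-lam - (k : ℂ) - 1)

/-- The constant produced by the shift of `M₂` by `t₂`, after `M₁` has been shifted by `t₁`. -/
noncomputable def constC₂ (α : ℝ) (lam : ℂ) (M₂ : MayaDiagram) (t₁ t₂ : ℤ) : ℂ :=
  if t₂ < 0 then
    rising ((α : ℂ) + 1 + lam) t₂.natAbs / rising ((α : ℂ) - (t₁ : ℂ) + 1) t₂.natAbs
  else if t₂ = 0 then 1
  else
    (∏ k ∈ Finset.range t₂.natAbs \ M₂.leftSet, ((α : ℂ) - (t₁ : ℂ) - (k : ℂ)))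
      * (∏ m' ∈ M₂.leftSet, ((α : ℂ) - (t₁ : ℂ) - (m' : ℂ)))
      / ∏ k ∈ Finset.range t₂.natAbs \ M₂.leftSet, (lam + (α : ℂ) - (k : ℂ))

/-- The double products over the encodings `M₁ = (n' | n)` and `M₂ = (m' | m)`. -/
noncomputable def constC₃ (α : ℝ) (M₁ M₂ : MayaDiagram) : ℂ :=
  (∏ n ∈ M₁.rightSet, ∏ m' ∈ M₂.leftSet, ((m' : ℂ) - (α : ℂ) - (n : ℂ)))
    * (∏ m ∈ M₂.rightSet, ∏ n' ∈ M₁.leftSet, ((n' : ℂ) - (α : ℂ) - (m : ℂ)))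
    * (∏ n ∈ M₁.rightSet, ∏ n' ∈ M₁.leftSet, ((n : ℂ) + (n' : ℂ) + 1))
    * (∏ m ∈ M₂.rightSet, ∏ m' ∈ M₂.leftSet, ((m : ℂ) + (m' : ℂ) + 1))

open scoped ContDiff Topology

/-! A shift is a chain of unit shifts, and a unit shift is one Wronskian identity. Dividing r
functions f_j and a function g by g, and expanding along the column of the constant 1, gives Wr[...,
g, ...] = ± g^(r+1) Wr[(f_j/g)'] (`wronskianDet_append_cons`).

Let g be a seed function of degree 0, that is 1, e^x, x^(-α) or e^x x^(-α). Then f ↦ (f/g)' maps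
each of the four seed families, and h, to itself with α changed by ±1, up to a constant and a common
gauge factor e^(Ex) x^Q. Degrees drop by one in the family of g, rise by one in the conjugate family
(the other half of the encoding of the same diagram), and stay fixed in the other two. The prefactor
of Ω absorbs the gauge factors, which gives the four removal formulas `omegaFirst_laguerre_zero`,
`omegaFirst_expPowLaguerre_zero`, `omegaFirst_expLaguerre_zero` and `omegaFirst_powLaguerre_zero`.

On diagrams, removing an entry 0 from the left half performs a unit shift of a diagram whose box -1
is empty; removing an entry 0 from the right half undoes a unit shift of a diagram whose box -1 is
filled. The constants C₁, C₂, C₃ obey matching recursions, up to signs that depend only on the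
diagrams. The formula follows by induction on |t₂| with M₁ canonical and t₁ = 0, then on |t₁|. Only
positive shifts across a filled box need the one-step relation inverted; the hypotheses on the
parameters make the divisors non-zero. -/

/-! ### Wronskian determinants -/

theorem wronskianDet_eq_det {fs : List (ℝ → ℂ)} {n : ℕ} (h : fs.length = n) (x : ℝ) :
    wronskianDet fs x =
      Matrix.det (Matrix.of fun i j : Fin n => iteratedDeriv (i : ℕ) (fs.getD j 0) x) := by
  subst h
  unfold wronskianDet
  congr 1
  ext i j
  simp

theorem wronskianDet_map {ι : Type*} (J : List ι) (f : ι → ℝ → ℂ) (x : ℝ) :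
    wronskianDet (J.map f) x =
      Matrix.det (Matrix.of fun i j : Fin J.length => iteratedDeriv (i : ℕ) (f J[j]) x) := by
  rw [wronskianDet_eq_det (n := J.length) (by simp)]
  congr 1
  ext i j
  simp

theorem wronskianDet_map_congr {ι : Type*} {J : List ι} {f g : ι → ℝ → ℂ} {x : ℝ}
    (h : ∀ j ∈ J, f j =ᶠ[𝓝 x] g j) : wronskianDet (J.map f) x = wronskianDet (J.map g) x := by
  rw [wronskianDet_map, wronskianDet_map]
  congr 1
  ext i j
  exact (h _ (List.getElem_mem _)).iteratedDeriv_eq _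

theorem wronskianDet_map_const_mul {ι : Type*} (J : List ι) (c : ι → ℂ) (f : ι → ℝ → ℂ) (x : ℝ) :
    wronskianDet (J.map fun j y => c j * f j y) x = (J.map c).prod * wronskianDet (J.map f) x := by
  rw [wronskianDet_map, wronskianDet_map, ← Fin.prod_univ_fun_getElem J c, ← Matrix.det_mul_row]
  congr 1
  ext i j
  simp

/-- A common smooth factor comes out of a Wronskian. -/
theorem wronskianDet_map_mul {ι : Type*} {J : List ι} {w : ℝ → ℂ} {f : ι → ℝ → ℂ} {x : ℝ}
    (hw : ContDiffAt ℝ ∞ w x) (hf : ∀ j ∈ J, ContDiffAt ℝ ∞ (f j) x) :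
    wronskianDet (J.map fun j y => w y * f j y) x =
      w x ^ J.length * wronskianDet (J.map f) x := by
  rw [wronskianDet_map, wronskianDet_map]
  -- By the Leibniz rule the derivative matrix of the products w f_j is T times that of the f_j; T
  -- is lower triangular with diagonal w x.
  set T : Matrix (Fin J.length) (Fin J.length) ℂ :=
    Matrix.of fun i k => ((i : ℕ).choose k : ℂ) * iteratedDeriv ((i : ℕ) - k) w x with hT
  have hdet : T.det = w x ^ J.length := by
    rw [Matrix.det_of_isLowerTriangular]
    · simp [hT]
    · intro i j hij
      have : (i : ℕ) < j := hij
      simp [hT, Nat.choose_eq_zero_of_lt this]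
  rw [← hdet, ← Matrix.det_mul]
  congr 1
  ext i j
  have hj : ContDiffAt ℝ ((i : ℕ) : ℕ∞ω) (f J[j]) x :=
    (hf _ (List.getElem_mem _)).of_le (mod_cast le_top)
  have hw' : ContDiffAt ℝ ((i : ℕ) : ℕ∞ω) w x := hw.of_le (mod_cast le_top)
  have key := iteratedDeriv_mul hj hw'
  have hcomm : (fun y => w y * f J[j] y) = f J[j] * w := by
    ext y; simp [mul_comm]
  rw [Matrix.mul_apply]
  simp only [Matrix.of_apply, hT]
  rw [hcomm, key, Fin.sum_univ_eq_sum_range (fun k => ((i : ℕ).choose k : ℂ) *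
    iteratedDeriv ((i : ℕ) - k) w x * iteratedDeriv k (f J[j]) x)]
  rw [← Finset.sum_subset (Finset.range_subset_range.2 (Nat.succ_le_of_lt i.2))]
  · exact Finset.sum_congr rfl fun k _ => by ring
  · intro k _ hk
    have : (i : ℕ) < k := by simpa using hk
    simp [Nat.choose_eq_zero_of_lt this]

/-- Expansion of a Wronskian along a column that holds the constant function `1`. -/
theorem wronskianDet_append_one_cons {ι : Type*} (A B : List ι) (f : ι → ℝ → ℂ) (x : ℝ) :
    wronskianDet (A.map f ++ (fun _ => 1) :: B.map f) x =
      (-1) ^ A.length * wronskianDet ((A ++ B).map fun j => deriv (f j)) x := by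
  rw [wronskianDet_eq_det (n := A.length + B.length + 1) (by simp; omega),
    wronskianDet_eq_det (n := A.length + B.length) (by simp),
    Matrix.det_succ_column _ (⟨A.length, by omega⟩ : Fin (A.length + B.length + 1)),
    Finset.sum_eq_single 0]
  · have h0 : (Matrix.of fun i j : Fin (A.length + B.length + 1) => iteratedDeriv (i : ℕ)
        ((A.map f ++ (fun _ => 1) :: B.map f).getD j 0) x) 0 ⟨A.length, by omega⟩ = 1 := by
      simp
    rw [h0]
    simp only [Fin.val_zero, zero_add, mul_one]
    congr 2
    ext i j
    simp only [Matrix.submatrix_apply, Matrix.of_apply, Fin.zero_succAbove, Fin.val_succ]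
    rw [iteratedDeriv_succ']
    congr 1
    rcases lt_or_ge (j : ℕ) A.length with hj | hj
    · rw [Fin.succAbove_of_castSucc_lt _ _ (by simpa [Fin.lt_def] using hj)]
      simp [List.getElem?_append, hj]
    · rw [Fin.succAbove_of_le_castSucc _ _ (by simpa [Fin.le_def] using hj)]
      have hB : (j : ℕ) - A.length < B.length := by omega
      have h1 : ¬ (j : ℕ) + 1 < A.length := by omega
      simp [List.getElem?_append, List.getElem_append, not_lt.2 hj, h1, Nat.succ_sub hj, hB]
  · intro i _ hi
    have h0 : (Matrix.of fun i j : Fin (A.length + B.length + 1) => iteratedDeriv (i : ℕ)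
        ((A.map f ++ (fun _ => 1) :: B.map f).getD j 0) x) i ⟨A.length, by omega⟩ = 0 := by
      have : (i : ℕ) ≠ 0 := Fin.val_ne_of_ne hi
      simp [iteratedDeriv_const, this]
    rw [h0]
    simp
  · simp

/-- If every quotient `f j / g` has derivative `c j * w * F j`, then the Wronskian of `g` and the
functions `f j` is a multiple of the Wronskian of the functions `F j`. -/
theorem wronskianDet_append_cons {ι : Type*} {A B : List ι} {f F : ι → ℝ → ℂ} {c : ι → ℂ}
    {g w : ℝ → ℂ} {x : ℝ} (hg : ContDiffAt ℝ ∞ g x) (hgx : g x ≠ 0) (hw : ContDiffAt ℝ ∞ w x)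
    (hf : ∀ j ∈ A ++ B, ContDiffAt ℝ ∞ (f j) x) (hF : ∀ j ∈ A ++ B, ContDiffAt ℝ ∞ (F j) x)
    (h : ∀ j ∈ A ++ B, deriv (fun y => f j y / g y) =ᶠ[𝓝 x] fun y => c j * (w y * F j y)) :
    wronskianDet (A.map f ++ g :: B.map f) x =
      (-1) ^ A.length * g x ^ ((A ++ B).length + 1) * w x ^ (A ++ B).length *
        ((A ++ B).map c).prod * wronskianDet ((A ++ B).map F) x := by
  have hne : ∀ᶠ y in 𝓝 x, g y ≠ 0 := hg.continuousAt.eventually_ne hgx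
  -- The label `none` stands for g (and for g/g = 1), so that the whole list is a map over one index
  -- type and the factor g can be extracted from all columns at once.
  set q : Option ι → ℝ → ℂ := fun o => o.elim (fun _ => 1) (fun j y => f j y / g y) with hq
  set p : Option ι → ℝ → ℂ := fun o => o.elim g f with hp
  set J : List (Option ι) := A.map some ++ none :: B.map some with hJ
  have e1 : A.map f ++ g :: B.map f = J.map p := by simp [hJ, hp, Function.comp_def]
  have e2 : A.map (fun j y => f j y / g y) ++ (fun _ => (1 : ℂ)) :: B.map (fun j y => f j y / g y)
      = J.map q := by simp [hJ, hq, Function.comp_def]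
  have e3 : wronskianDet (J.map p) x = wronskianDet (J.map fun o y => g y * q o y) x := by
    refine wronskianDet_map_congr fun o _ => ?_
    filter_upwards [hne] with y hy
    cases o with
    | none => simp [hp, hq]
    | some j => simp only [hp, hq, Option.elim_some]; field_simp
  have e4 : ∀ o ∈ J, ContDiffAt ℝ ∞ (q o) x := by
    intro o ho
    cases o with
    | none => exact contDiffAt_const
    | some j =>
      have : j ∈ A ++ B := by simpa [hJ] using ho
      simp only [hq, Option.elim_some, div_eq_mul_inv]
      exact (hf j this).mul (hg.inv hgx)
  rw [e1, e3, wronskianDet_map_mul hg e4, ← e2, wronskianDet_append_one_cons,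
    wronskianDet_map_congr h,
    wronskianDet_map_const_mul (A ++ B) c (fun j y => w y * F j y), wronskianDet_map_mul hw hF]
  have : J.length = (A ++ B).length + 1 := by simp [hJ]; omega
  rw [this]
  ring

/-! ### Contiguity relations of the Laguerre polynomials -/

/-- The coefficient of `x ^ k` in `laguerreL n a x`. -/
noncomputable def laguerreCoeff (n : ℕ) (a : ℝ) (k : ℕ) : ℝ :=
  (-1) ^ k * ((ascPochhammer ℝ (n - k)).eval (a + k + 1) / ((n - k).factorial : ℝ)) / k.factorial

theorem laguerreL_eq_sum (n : ℕ) (a x : ℝ) :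
    laguerreL n a x = ∑ k ∈ Finset.range (n + 1), laguerreCoeff n a k * x ^ k := by
  unfold laguerreL laguerreCoeff
  exact Finset.sum_congr rfl fun k _ => by ring

theorem ascPochhammer_eval_succ_left {R : Type*} [CommSemiring R] (n : ℕ) (z : R) :
    (ascPochhammer R (n + 1)).eval z = z * (ascPochhammer R n).eval (z + 1) := by
  simp [ascPochhammer_succ_left]

theorem laguerreL_zero (a x : ℝ) : laguerreL 0 a x = 1 := by
  simp [laguerreL]

theorem laguerreCoeff_self (n : ℕ) (a : ℝ) : laguerreCoeff n a n = (-1) ^ n / n.factorial := by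
  simp [laguerreCoeff]

theorem laguerreCoeff_succ_succ (n k : ℕ) (a : ℝ) :
    (k + 1) * laguerreCoeff (n + 1) a (k + 1) = -laguerreCoeff n (a + 1) k := by
  unfold laguerreCoeff
  rw [Nat.add_sub_add_right, Nat.factorial_succ]
  have : ((k : ℝ) + 1) ≠ 0 := by positivity
  have h2 : a + ((k + 1 : ℕ) : ℝ) + 1 = a + 1 + k + 1 := by push_cast; ring
  rw [h2]
  push_cast
  field_simp
  ring

theorem laguerreCoeff_sub_one {n k : ℕ} (hk : k ≤ n) (a : ℝ) :
    (k + a) * laguerreCoeff n a k = (n + a) * laguerreCoeff n (a - 1) k := by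
  obtain ⟨j, rfl⟩ := Nat.exists_eq_add_of_le hk
  unfold laguerreCoeff
  rw [Nat.add_sub_cancel_left]
  have h1 := ascPochhammer_eval_succ_left j (a + (k : ℝ))
  rw [ascPochhammer_succ_eval] at h1
  have h2 : a - 1 + (k : ℝ) + 1 = a + k := by ring
  rw [h2]
  push_cast
  linear_combination (-(-1) ^ k / ((j.factorial : ℝ) * k.factorial)) * h1

/-- Pascal's rule for the binomial coefficients in the definition. -/
theorem laguerreCoeff_succ_add_one {n k : ℕ} (hk : k ≤ n) (a : ℝ) :
    laguerreCoeff (n + 1) (a + 1) k = laguerreCoeff (n + 1) a k + laguerreCoeff n (a + 1) k := by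
  obtain ⟨j, rfl⟩ := Nat.exists_eq_add_of_le hk
  unfold laguerreCoeff
  rw [Nat.add_sub_cancel_left, show k + j + 1 - k = j + 1 by omega]
  have h1 := ascPochhammer_eval_succ_left j (a + (k : ℝ) + 1)
  have h2 := ascPochhammer_succ_eval j (a + 1 + (k : ℝ) + 1)
  have h3 : a + (k : ℝ) + 1 + 1 = a + 1 + k + 1 := by ring
  rw [h3] at h1
  rw [h1, h2, Nat.factorial_succ]
  push_cast
  have : ((j : ℝ) + 1) ≠ 0 := by positivity
  field_simp
  ring

theorem laguerreL_hasDerivAt (n : ℕ) (a x : ℝ) :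
    HasDerivAt (laguerreL n a)
      (∑ k ∈ Finset.range (n + 1), laguerreCoeff n a k * (k * x ^ (k - 1))) x := by
  have : laguerreL n a = fun x => ∑ k ∈ Finset.range (n + 1), laguerreCoeff n a k * x ^ k :=
    funext (laguerreL_eq_sum n a)
  rw [this]
  exact HasDerivAt.fun_sum fun k _ => (hasDerivAt_pow k x).const_mul _

theorem laguerreL_contDiff (n : ℕ) (a : ℝ) : ContDiff ℝ ∞ (laguerreL n a) := by
  have : laguerreL n a = fun x => ∑ k ∈ Finset.range (n + 1), laguerreCoeff n a k * x ^ k :=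
    funext (laguerreL_eq_sum n a)
  rw [this]
  fun_prop

theorem deriv_laguerreL_succ (n : ℕ) (a x : ℝ) :
    deriv (laguerreL (n + 1) a) x = -laguerreL n (a + 1) x := by
  rw [(laguerreL_hasDerivAt _ a x).deriv, Finset.sum_range_succ', laguerreL_eq_sum,
    ← Finset.sum_neg_distrib]
  simp only [Nat.cast_zero, zero_mul, mul_zero, add_zero]
  refine Finset.sum_congr rfl fun k _ => ?_
  have h := laguerreCoeff_succ_succ n k a
  push_cast
  linear_combination x ^ k * h

theorem deriv_laguerreL_zero (a x : ℝ) : deriv (laguerreL 0 a) x = 0 := by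
  have : laguerreL 0 a = fun _ => 1 := funext (laguerreL_zero a)
  simp [this]

theorem laguerreL_succ_add_one (n : ℕ) (a x : ℝ) :
    laguerreL (n + 1) (a + 1) x = laguerreL (n + 1) a x + laguerreL n (a + 1) x := by
  simp only [laguerreL_eq_sum]
  rw [Finset.sum_range_succ, Finset.sum_range_succ _ (n + 1), laguerreCoeff_self,
    laguerreCoeff_self, add_right_comm, ← Finset.sum_add_distrib]
  congr 1
  refine Finset.sum_congr rfl fun k hk => ?_
  rw [laguerreCoeff_succ_add_one (Nat.lt_succ_iff.1 (Finset.mem_range.1 hk))]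
  ring

/-- Differentiation rule for e^(-x) L_n^a. The relations below do the same for x^a L_n^a and x^a
e^(-x) L_n^a; with the plain derivative these are the four rules behind the removal formulas. -/
theorem laguerreL_sub_deriv (n : ℕ) (a x : ℝ) :
    laguerreL n a x - deriv (laguerreL n a) x = laguerreL n (a + 1) x := by
  cases n with
  | zero => simp [deriv_laguerreL_zero, laguerreL_zero]
  | succ n => rw [deriv_laguerreL_succ, laguerreL_succ_add_one]; ring

theorem mul_deriv_laguerreL_add (n : ℕ) (a x : ℝ) :
    x * deriv (laguerreL n a) x + a * laguerreL n a x = (n + a) * laguerreL n (a - 1) x := by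
  rw [(laguerreL_hasDerivAt _ a x).deriv, laguerreL_eq_sum, laguerreL_eq_sum, Finset.mul_sum,
    Finset.mul_sum, Finset.mul_sum, ← Finset.sum_add_distrib]
  refine Finset.sum_congr rfl fun k hk => ?_
  have h := laguerreCoeff_sub_one (Nat.lt_succ_iff.1 (Finset.mem_range.1 hk)) a
  cases k with
  | zero => simp at h ⊢; linear_combination h
  | succ k =>
    simp only [Nat.add_sub_cancel]
    linear_combination x ^ (k + 1) * h

theorem laguerreL_contiguous (n : ℕ) (a x : ℝ) :
    (n + a) * laguerreL n (a - 1) x - x * laguerreL n a x =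
      (n + 1) * laguerreL (n + 1) (a - 1) x := by
  have h1 := mul_deriv_laguerreL_add (n + 1) (a - 1) x
  have h2 := laguerreL_succ_add_one n (a - 1 - 1) x
  rw [deriv_laguerreL_succ] at h1
  rw [sub_add_cancel] at h1 h2
  push_cast at h1
  linear_combination h1 - (n + a) * h2

/-- Differentiation rule for x^a e^(-x) L_n^a, the only one that raises the degree. -/
theorem mul_deriv_laguerreL_add_sub (n : ℕ) (a x : ℝ) :
    x * deriv (laguerreL n a) x + (a - x) * laguerreL n a x =
      (n + 1) * laguerreL (n + 1) (a - 1) x := by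
  linear_combination mul_deriv_laguerreL_add n a x + laguerreL_contiguous n a x

/-! ### Kummer's function: convergence and contiguity relations -/

theorem rising_zero (z : ℂ) : rising z 0 = 1 := by simp [rising]

theorem rising_succ (z : ℂ) (n : ℕ) : rising z (n + 1) = rising z n * (z + n) := by
  simp [rising, ascPochhammer_succ_eval]

theorem rising_succ_left (z : ℂ) (n : ℕ) : rising z (n + 1) = z * rising (z + 1) n := by
  simp [rising, ascPochhammer_eval_succ_left]

theorem rising_ne_zero {b : ℂ} (hb : ∀ k : ℕ, b ≠ -(k : ℂ)) (n : ℕ) : rising b n ≠ 0 := by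
  induction n with
  | zero => simp [rising_zero]
  | succ n ih =>
    rw [rising_succ]
    refine mul_ne_zero ih fun h => hb n ?_
    linear_combination h

/-- The coefficient of `x ^ k` in `kummerM a b x`. -/
noncomputable def kummerCoeff (a b : ℂ) (k : ℕ) : ℂ := rising a k / rising b k / k.factorial

theorem kummerM_eq_tsum (a b x : ℂ) : kummerM a b x = ∑' k, kummerCoeff a b k * x ^ k := by
  unfold kummerM kummerCoeff
  exact tsum_congr fun k => by ring

theorem kummerCoeff_zero (a b : ℂ) : kummerCoeff a b 0 = 1 := by
  simp [kummerCoeff, rising_zero]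

theorem kummerCoeff_succ {b : ℂ} (a : ℂ) (hb : ∀ k : ℕ, b ≠ -(k : ℂ)) (k : ℕ) :
    (k + 1) * (b + k) * kummerCoeff a b (k + 1) = (a + k) * kummerCoeff a b k := by
  have h1 : b + k ≠ 0 := fun h => hb k (by linear_combination h)
  have h2 := rising_ne_zero hb k
  have h3 : ((k : ℂ) + 1) ≠ 0 := by exact_mod_cast Nat.succ_ne_zero k
  have h4 : (k.factorial : ℂ) ≠ 0 := by exact_mod_cast k.factorial_ne_zero
  unfold kummerCoeff
  rw [rising_succ, rising_succ, Nat.factorial_succ]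
  push_cast
  field_simp

theorem tendsto_kummerCoeff_ratio (a b x : ℂ) :
    Filter.Tendsto (fun k : ℕ => (a + k) / (b + k) * x / (k + 1)) Filter.atTop (𝓝 0) := by
  have h1 : Filter.Tendsto (fun k : ℕ => (a + 1 * (k : ℂ)) / (b + 1 * (k : ℂ))) Filter.atTop
      (𝓝 (1 / 1)) := tendsto_add_mul_div_add_mul_atTop_nhds a b 1 one_ne_zero
  have h2 := ((h1.mul_const x).mul (tendsto_one_div_add_atTop_nhds_zero_nat (𝕜 := ℂ)))
  rw [mul_zero] at h2
  refine h2.congr fun k => ?_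
  simp only [one_mul]
  ring

/-- Ratio test: the quotient of consecutive terms tends to 0, so the series converges everywhere. -/
theorem kummerM_summable {b : ℂ} (a x : ℂ) (hb : ∀ k : ℕ, b ≠ -(k : ℂ)) :
    Summable fun k => kummerCoeff a b k * x ^ k := by
  have ht := (tendsto_kummerCoeff_ratio a b x).norm
  rw [norm_zero] at ht
  refine summable_of_ratio_norm_eventually_le (r := 1 / 2) (by norm_num) ?_
  filter_upwards [ht.eventually_le_const (show (0 : ℝ) < 1 / 2 by norm_num)] with k hk
  have h1 : b + k ≠ 0 := fun h => hb k (by linear_combination h)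
  have h3 : ((k : ℂ) + 1) ≠ 0 := by exact_mod_cast Nat.succ_ne_zero k
  have e : kummerCoeff a b (k + 1) * x ^ (k + 1) =
      (a + k) / (b + k) * x / (k + 1) * (kummerCoeff a b k * x ^ k) := by
    field_simp
    linear_combination x * x ^ k * kummerCoeff_succ a hb k
  rw [e, norm_mul]
  gcongr

theorem kummerCoeff_succ_shift (a b : ℂ) (k : ℕ) :
    (k + 1) * kummerCoeff a b (k + 1) = a / b * kummerCoeff (a + 1) (b + 1) k := by
  have h3 : ((k : ℂ) + 1) ≠ 0 := by exact_mod_cast Nat.succ_ne_zero k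
  unfold kummerCoeff
  rw [rising_succ_left, rising_succ_left, Nat.factorial_succ]
  push_cast
  field_simp

theorem ne_neg_natCast_add_one {b : ℂ} (hb : ∀ k : ℕ, b ≠ -(k : ℂ)) (k : ℕ) : b + 1 ≠ -(k : ℂ) :=
  fun h => hb (k + 1) (by push_cast; linear_combination h)

theorem mul_kummerCoeff {b : ℂ} (a : ℂ) (hb : ∀ k : ℕ, b ≠ -(k : ℂ)) (k : ℕ) :
    b * kummerCoeff a b k = (b + k) * kummerCoeff a (b + 1) k := by
  have h2 := rising_ne_zero hb k
  have h2' := rising_ne_zero (ne_neg_natCast_add_one hb) k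
  have := (rising_succ_left b k).symm.trans (rising_succ b k)
  have h4 : (k.factorial : ℂ) ≠ 0 := by exact_mod_cast k.factorial_ne_zero
  unfold kummerCoeff
  field_simp
  linear_combination rising a k * this

theorem kummerM_hasDerivAt {b : ℂ} (a : ℂ) (hb : ∀ k : ℕ, b ≠ -(k : ℂ)) (x : ℂ) :
    HasDerivAt (kummerM a b) (a / b * kummerM (a + 1) (b + 1) x) x := by
  set R : ℝ := ‖x‖ + 1 with hR
  have hfun : kummerM a b = fun x => ∑' k, kummerCoeff a b k * x ^ k :=
    funext (kummerM_eq_tsum a b)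
  have hshift : ∀ y : ℂ, ∀ k : ℕ, kummerCoeff a b (k + 1) * (((k + 1 : ℕ) : ℂ) * y ^ (k + 1 - 1)) =
      a / b * (kummerCoeff (a + 1) (b + 1) k * y ^ k) := by
    intro y k
    have := kummerCoeff_succ_shift a b k
    push_cast
    linear_combination y ^ k * this
  have hs : ∀ y : ℂ, Summable fun k : ℕ => kummerCoeff a b k * ((k : ℂ) * y ^ (k - 1)) := by
    intro y
    rw [← summable_nat_add_iff 1]
    simp only [hshift]
    exact (kummerM_summable (a + 1) y (ne_neg_natCast_add_one hb)).mul_left _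
  -- On the ball of radius R the differentiated series is dominated by its own absolute values at
  -- the point R.
  have key := hasDerivAt_tsum_of_isPreconnected (t := Metric.ball (0 : ℂ) R) (hs (R : ℂ)).norm
    Metric.isOpen_ball (convex_ball _ _).isPreconnected
    (g := fun k y => kummerCoeff a b k * y ^ k)
    (g' := fun k y => kummerCoeff a b k * ((k : ℂ) * y ^ (k - 1)))
    (fun k y _ => (hasDerivAt_pow k y).const_mul _) ?_ (y₀ := x) (by simp [hR])
    (kummerM_summable a x hb) (y := x) (by simp [hR])
  · have e : a / b * kummerM (a + 1) (b + 1) x =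
        ∑' k : ℕ, kummerCoeff a b k * ((k : ℂ) * x ^ (k - 1)) := by
      rw [(hs x).tsum_eq_zero_add, tsum_congr (hshift x), tsum_mul_left, kummerM_eq_tsum]
      simp
    rw [hfun, e]
    exact key
  · intro k y hy
    have hy' : ‖y‖ ≤ R := by simpa using (Metric.mem_ball.1 hy).le
    have hR0 : 0 ≤ R := by positivity
    simp only [norm_mul, norm_pow, Complex.norm_real, Real.norm_eq_abs, abs_of_nonneg hR0]
    gcongr

theorem kummerM_differentiable {b : ℂ} (a : ℂ) (hb : ∀ k : ℕ, b ≠ -(k : ℂ)) :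
    Differentiable ℂ (kummerM a b) :=
  fun x => (kummerM_hasDerivAt a hb x).differentiableAt

theorem deriv_kummerM {b : ℂ} (a : ℂ) (hb : ∀ k : ℕ, b ≠ -(k : ℂ)) (x : ℂ) :
    deriv (kummerM a b) x = a / b * kummerM (a + 1) (b + 1) x :=
  (kummerM_hasDerivAt a hb x).deriv

/-- Differentiation rule for e^(-x) M(a, b, x), the counterpart of `laguerreL_sub_deriv`; with
`deriv_kummerM`, `mul_deriv_kummerM_add` and `mul_deriv_kummerM_add_sub` it says how h transforms
under the four choices of g. -/
theorem kummerM_sub_deriv {b : ℂ} (a : ℂ) (hb : ∀ k : ℕ, b ≠ -(k : ℂ)) (x : ℂ) :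
    deriv (kummerM a b) x - kummerM a b x = (a - b) / b * kummerM a (b + 1) x := by
  have hb' := ne_neg_natCast_add_one hb
  rw [deriv_kummerM a hb]
  simp only [kummerM_eq_tsum]
  rw [← tsum_mul_left, ← tsum_mul_left,
    ← ((kummerM_summable (a + 1) x hb').mul_left _).tsum_sub (kummerM_summable a x hb)]
  refine tsum_congr fun k => ?_
  have h0 : b ≠ 0 := by simpa using hb 0
  have h1 : b + k ≠ 0 := fun h => hb k (by linear_combination h)
  have h2 := rising_ne_zero hb k
  have h2' := rising_ne_zero hb' k
  have e1 := kummerCoeff_succ_shift a b k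
  have e2 := kummerCoeff_succ a hb k
  have e3 := mul_kummerCoeff a hb k
  rw [← mul_assoc, ← e1, ← sub_mul, ← mul_assoc]
  congr 1
  field_simp
  apply mul_left_cancel₀ h1
  linear_combination b * e2 + (a - b) * e3

theorem kummerM_summable_natCast_mul {b : ℂ} (a x : ℂ) (hb : ∀ k : ℕ, b ≠ -(k : ℂ)) :
    Summable fun k : ℕ => (k : ℂ) * kummerCoeff a b k * x ^ k := by
  rw [← summable_nat_add_iff 1]
  refine ((kummerM_summable (a + 1) x (ne_neg_natCast_add_one hb)).mul_left (a / b * x)).congr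
    fun k => ?_
  have := kummerCoeff_succ_shift a b k
  push_cast
  linear_combination -x ^ (k + 1) * this

theorem mul_deriv_kummerM {b : ℂ} (a : ℂ) (hb : ∀ k : ℕ, b ≠ -(k : ℂ)) (x : ℂ) :
    x * deriv (kummerM a b) x = ∑' k : ℕ, (k : ℂ) * kummerCoeff a b k * x ^ k := by
  rw [(kummerM_summable_natCast_mul a x hb).tsum_eq_zero_add, deriv_kummerM a hb, kummerM_eq_tsum,
    ← tsum_mul_left, ← tsum_mul_left]
  simp only [Nat.cast_zero, zero_mul, zero_add]
  refine tsum_congr fun k => ?_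
  have := kummerCoeff_succ_shift a b k
  push_cast
  linear_combination -x ^ (k + 1) * this

theorem mul_deriv_kummerM_add {b : ℂ} (a : ℂ) (hb : ∀ k : ℕ, b ≠ -(k : ℂ)) (x : ℂ) :
    x * deriv (kummerM a (b + 1)) x + b * kummerM a (b + 1) x = b * kummerM a b x := by
  have hb' := ne_neg_natCast_add_one hb
  rw [mul_deriv_kummerM a hb', kummerM_eq_tsum, kummerM_eq_tsum, ← tsum_mul_left, ← tsum_mul_left,
    ← (kummerM_summable_natCast_mul a x hb').tsum_add ((kummerM_summable a x hb').mul_left _)]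
  refine tsum_congr fun k => ?_
  linear_combination -x ^ k * mul_kummerCoeff a hb k

theorem kummerM_contiguous {b : ℂ} (a : ℂ) (hb : ∀ k : ℕ, b ≠ -(k : ℂ)) (x : ℂ) :
    b * (kummerM (a + 1) b x - kummerM a b x) = x * kummerM (a + 1) (b + 1) x := by
  simp only [kummerM_eq_tsum]
  rw [(kummerM_summable (a + 1) x hb).tsum_eq_zero_add, (kummerM_summable a x hb).tsum_eq_zero_add,
    kummerCoeff_zero, kummerCoeff_zero, add_sub_add_left_eq_sub,
    ← ((summable_nat_add_iff 1).2 (kummerM_summable (a + 1) x hb)).tsum_sub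
      ((summable_nat_add_iff 1).2 (kummerM_summable a x hb)), ← tsum_mul_left, ← tsum_mul_left]
  refine tsum_congr fun k => ?_
  have h0 : b ≠ 0 := by simpa using hb 0
  have h3 : ((k : ℂ) + 1) ≠ 0 := by exact_mod_cast Nat.succ_ne_zero k
  have e1 := kummerCoeff_succ_shift (a + 1) b k
  have e2 := kummerCoeff_succ_shift a b k
  have e3 : (a + 1) * kummerCoeff (a + 1 + 1) (b + 1) k =
      (a + 1 + k) * kummerCoeff (a + 1) (b + 1) k := by
    have := (rising_succ_left (a + 1) k).symm.trans (rising_succ (a + 1) k)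
    unfold kummerCoeff
    linear_combination this / (rising (b + 1) k * k.factorial)
  field_simp at e1 e2
  -- The constant terms have cancelled, so coefficient k + 1 on the left is compared with
  -- coefficient k on the right; the factor (a + 1 + k) - a = k + 1 then divides out.
  have key : b * (kummerCoeff (a + 1) b (k + 1) - kummerCoeff a b (k + 1)) =
      kummerCoeff (a + 1) (b + 1) k := by
    apply mul_left_cancel₀ h3
    linear_combination e1 - e2 + e3
  linear_combination x ^ (k + 1) * key

theorem mul_deriv_kummerM_add_sub {b : ℂ} (a : ℂ) (hb : ∀ k : ℕ, b ≠ -(k : ℂ)) (x : ℂ) :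
    x * deriv (kummerM a (b + 1)) x + (b - x) * kummerM a (b + 1) x = b * kummerM (a - 1) b x := by
  have h := kummerM_contiguous (a - 1) hb x
  rw [sub_add_cancel] at h
  linear_combination mul_deriv_kummerM_add a hb x + h

/-! ### Gauge factors e^(Ex) x^Q and derivatives of quotients -/

/-- The function `e^{E x} x^Q`. -/
noncomputable def expPow (E Q x : ℝ) : ℂ := ((Real.exp (E * x) * x ^ Q : ℝ) : ℂ)

/-- The function `e^{E x} x^Q L_k^b(s x)`. -/
noncomputable def expPowLaguerre (E Q s : ℝ) (k : ℕ) (b x : ℝ) : ℂ :=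
  ((Real.exp (E * x) * x ^ Q * laguerreL k b (s * x) : ℝ) : ℂ)

theorem expPow_mul {x : ℝ} (hx : 0 < x) (E Q E' Q' : ℝ) :
    expPow E Q x * expPow E' Q' x = expPow (E + E') (Q + Q') x := by
  unfold expPow
  rw [add_mul, Real.exp_add, Real.rpow_add hx]
  push_cast
  ring

theorem expPow_zero_zero (x : ℝ) : expPow 0 0 x = 1 := by simp [expPow]

theorem expPow_pow {x : ℝ} (hx : 0 < x) (E Q : ℝ) (n : ℕ) :
    expPow E Q x ^ n = expPow (n * E) (n * Q) x := by
  induction n with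
  | zero => simp [expPow_zero_zero]
  | succ n ih =>
    rw [pow_succ, ih, expPow_mul hx]
    push_cast
    ring_nf

theorem expPow_ne_zero {x : ℝ} (hx : 0 < x) (E Q : ℝ) : expPow E Q x ≠ 0 := by
  unfold expPow
  have := Real.rpow_pos_of_pos hx Q
  exact_mod_cast (mul_pos (Real.exp_pos _) this).ne'

theorem expPow_contDiffAt {x : ℝ} (hx : 0 < x) (E Q : ℝ) : ContDiffAt ℝ ∞ (expPow E Q) x := by
  unfold expPow
  refine Complex.ofRealCLM.contDiff.contDiffAt.comp x (ContDiffAt.mul ?_ ?_)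
  · fun_prop
  · exact Real.contDiffAt_rpow_const_of_ne hx.ne'

theorem expPowLaguerre_eq (E Q s : ℝ) (k : ℕ) (b x : ℝ) :
    expPowLaguerre E Q s k b x = expPow E Q x * ((laguerreL k b (s * x) : ℝ) : ℂ) := by
  simp [expPowLaguerre, expPow]

theorem expPowLaguerre_contDiffAt {x : ℝ} (hx : 0 < x) (E Q s : ℝ) (k : ℕ) (b : ℝ) :
    ContDiffAt ℝ ∞ (expPowLaguerre E Q s k b) x := by
  have : expPowLaguerre E Q s k b =
      fun x => expPow E Q x * ((laguerreL k b (s * x) : ℝ) : ℂ) :=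
    funext (expPowLaguerre_eq E Q s k b)
  rw [this]
  refine (expPow_contDiffAt hx E Q).mul ?_
  refine Complex.ofRealCLM.contDiff.contDiffAt.comp x ?_
  exact ((laguerreL_contDiff k b).comp (contDiff_const.mul contDiff_id)).contDiffAt

theorem hasDerivAt_expPow {x : ℝ} (hx : 0 < x) (E Q : ℝ) :
    HasDerivAt (expPow E Q) (expPow E (Q - 1) x * ((E * x + Q : ℝ) : ℂ)) x := by
  have h1 : HasDerivAt (fun y => Real.exp (E * y)) (Real.exp (E * x) * E) x := by
    simpa using ((hasDerivAt_id x).const_mul E).exp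
  have h2 := Real.hasDerivAt_rpow_const (p := Q) (Or.inl hx.ne')
  have h3 : HasDerivAt (expPow E Q) _ x := (h1.mul h2).ofReal_comp
  refine h3.congr_deriv ?_
  have h4 : x ^ Q = x ^ (Q - 1) * x := by rw [← Real.rpow_add_one hx.ne', sub_add_cancel]
  unfold expPow
  rw [h4]
  push_cast
  ring

/-- The derivative of `e^{E x} x^Q f(x)`, where `E x f + Q f + x f'` is `x^δ` times a multiple of
`F`. -/
theorem hasDerivAt_expPow_mul {x : ℝ} (hx : 0 < x) {E Q δ Q' : ℝ} {f F : ℝ → ℂ} {f' c : ℂ}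
    (hf : HasDerivAt f f' x)
    (h : ((E * x + Q : ℝ) : ℂ) * f x + x * f' = c * ((x ^ δ : ℝ) : ℂ) * F x)
    (hQ : Q - 1 + δ = Q') :
    HasDerivAt (fun y => expPow E Q y * f y) (c * (expPow E Q' x * F x)) x := by
  refine ((hasDerivAt_expPow hx E Q).mul hf).congr_deriv ?_
  have e1 : expPow E Q x = expPow E (Q - 1) x * x := by
    have := expPow_mul hx E (Q - 1) 0 1
    rw [add_zero, sub_add_cancel] at this
    rw [← this]
    simp [expPow]
  have e2 : expPow E Q' x = expPow E (Q - 1) x * ((x ^ δ : ℝ) : ℂ) := by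
    have := expPow_mul hx E (Q - 1) 0 δ
    rw [add_zero, hQ] at this
    rw [← this]
    simp [expPow]
  rw [e1, e2]
  linear_combination expPow E (Q - 1) x * h

/-- The quotient is e^((e-E)y) y^(q-Q) L(sy); its derivative is e^((e-E)y) y^(q-Q-1) times the
bracket in `h`. In the applications δ is 1 when the bracket has a factor y, and 0 otherwise.
`deriv_hFirst_div` is the analogue for h. -/
theorem deriv_expPowLaguerre_div {x : ℝ} (hx : 0 < x) {E Q E' Q' e q e' q' b b' s c : ℝ} {k k' : ℕ}
    (δ : ℝ) (he : e - E = E' + e') (hq : q - Q - 1 + δ = Q' + q')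
    (h : ∀ y : ℝ, 0 < y → ((e - E) * y + (q - Q)) * laguerreL k b (s * y)
      + s * y * deriv (laguerreL k b) (s * y) = c * y ^ δ * laguerreL k' b' (s * y)) :
    deriv (fun y => expPowLaguerre e q s k b y / expPow E Q y) =ᶠ[𝓝 x]
      fun y => (c : ℂ) * (expPow E' Q' y * expPowLaguerre e' q' s k' b' y) := by
  have hev : ∀ y : ℝ, 0 < y → (fun y => expPowLaguerre e q s k b y / expPow E Q y) =ᶠ[𝓝 y]
      fun y => expPow (e - E) (q - Q) y * ((laguerreL k b (s * y) : ℝ) : ℂ) := by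
    intro y hy
    filter_upwards [lt_mem_nhds hy] with z hz
    have h1 := expPow_mul hz (e - E) (q - Q) E Q
    rw [sub_add_cancel, sub_add_cancel] at h1
    rw [expPowLaguerre_eq, ← h1]
    field_simp [expPow_ne_zero hz]
  filter_upwards [lt_mem_nhds hx] with y hy
  rw [(hev y hy).deriv_eq]
  have hd : HasDerivAt (fun y => ((laguerreL k b (s * y) : ℝ) : ℂ))
      ((deriv (laguerreL k b) (s * y) * s : ℝ) : ℂ) y := by
    have h1 : HasDerivAt (laguerreL k b) (deriv (laguerreL k b) (s * y)) (s * y) :=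
      ((laguerreL_contDiff k b).differentiable (by simp)).differentiableAt.hasDerivAt
    have h2 : HasDerivAt (fun y : ℝ => s * y) s y := by
      simpa using (hasDerivAt_id y).const_mul s
    exact (h1.comp y h2).ofReal_comp
  rw [(hasDerivAt_expPow_mul hy (c := (c : ℂ)) (δ := δ)
    (F := fun y => ((laguerreL k' b' (s * y) : ℝ) : ℂ)) hd ?_ hq).deriv]
  · rw [expPowLaguerre_eq, ← mul_assoc (expPow E' Q' y), expPow_mul hy, he]
  · have := h y hy
    have h' := congrArg (fun r : ℝ => (r : ℂ)) this
    push_cast at h' ⊢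
    linear_combination h'

theorem hFirst_hasDerivAt {α : ℝ} (lam : ℂ) (hα : ∀ k : ℕ, (α : ℂ) + 1 ≠ -(k : ℂ)) (x : ℝ) :
    HasDerivAt (hFirst α lam) (deriv (kummerM (-lam) ((α : ℂ) + 1)) (x : ℂ)) x :=
  HasDerivAt.comp_ofReal ((kummerM_differentiable (-lam) hα).differentiableAt.hasDerivAt)

theorem hFirst_contDiffAt {α : ℝ} (lam : ℂ) (hα : ∀ k : ℕ, (α : ℂ) + 1 ≠ -(k : ℂ)) (x : ℝ) :
    ContDiffAt ℝ ∞ (hFirst α lam) x := by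
  -- Complex differentiability everywhere gives smoothness, which is then restricted to the real
  -- line.
  have h1 : ContDiff ℂ ∞ (kummerM (-lam) ((α : ℂ) + 1)) :=
    (kummerM_differentiable (-lam) hα).contDiff
  exact ((h1.restrict_scalars ℝ).comp Complex.ofRealCLM.contDiff).contDiffAt

theorem deriv_hFirst_div {x : ℝ} (hx : 0 < x) {E Q E' Q' α α' : ℝ} {lam lam' c : ℂ}
    (δ : ℝ) (hα : ∀ k : ℕ, (α : ℂ) + 1 ≠ -(k : ℂ)) (he : -E = E') (hq : -Q - 1 + δ = Q')
    (h : ∀ y : ℝ, 0 < y → (-E * y - Q) * hFirst α lam y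
      + y * deriv (kummerM (-lam) ((α : ℂ) + 1)) y = c * (y ^ δ : ℝ) * hFirst α' lam' y) :
    deriv (fun y => hFirst α lam y / expPow E Q y) =ᶠ[𝓝 x]
      fun y => c * (expPow E' Q' y * hFirst α' lam' y) := by
  have hev : ∀ y : ℝ, 0 < y → (fun y => hFirst α lam y / expPow E Q y) =ᶠ[𝓝 y]
      fun y => expPow (-E) (-Q) y * hFirst α lam y := by
    intro y hy
    filter_upwards [lt_mem_nhds hy] with z hz
    have h1 := expPow_mul hz (-E) (-Q) E Q
    rw [neg_add_cancel, neg_add_cancel, expPow_zero_zero] at h1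
    rw [div_eq_iff (expPow_ne_zero hz E Q)]
    linear_combination -hFirst α lam z * h1
  filter_upwards [lt_mem_nhds hx] with y hy
  subst he
  rw [(hev y hy).deriv_eq, (hasDerivAt_expPow_mul hy (c := c) (δ := δ)
    (F := hFirst α' lam') (hFirst_hasDerivAt lam hα y) ?_ hq).deriv]
  rw [← h y hy]
  push_cast
  ring

/-! ### Labelled seed functions -/

/-- Labels of the seed functions and of the solution of the first kind. -/
inductive SeedIndex
  | laguerre (k : ℕ)
  | expLaguerre (k : ℕ)
  | powLaguerre (k : ℕ)
  | expPowLaguerre (k : ℕ)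
  | kummer

/-- The function with a given label. -/
noncomputable def seedFn (α : ℝ) (lam : ℂ) : SeedIndex → ℝ → ℂ
  | .laguerre k => expPowLaguerre 0 0 1 k α
  | .expLaguerre k => expPowLaguerre 1 0 (-1) k α
  | .powLaguerre k => expPowLaguerre 0 (-α) 1 k (-α)
  | .expPowLaguerre k => expPowLaguerre 1 (-α) (-1) k (-α)
  | .kummer => hFirst α lam

/-- The labels of the seed functions with given degrees, followed by that of `h`. -/
def seedIndices (n m m' n' : List ℕ) : List SeedIndex :=
  n.map .laguerre ++ m.map .expLaguerre ++ m'.map .powLaguerre ++ n'.map .expPowLaguerre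
    ++ [.kummer]

theorem seedFn_contDiffAt {α : ℝ} (lam : ℂ) (hα : ∀ k : ℕ, (α : ℂ) + 1 ≠ -(k : ℂ)) {x : ℝ}
    (hx : 0 < x) (j : SeedIndex) : ContDiffAt ℝ ∞ (seedFn α lam j) x := by
  cases j
  case kummer => exact hFirst_contDiffAt lam hα x
  all_goals exact expPowLaguerre_contDiffAt hx _ _ _ _ _

theorem omegaFirst_eq (n m m' n' : List ℕ) (α : ℝ) (lam : ℂ) (x : ℝ) :
    omegaFirst n m m' n' α lam x =
      expPow (-((m.length : ℝ) + n'.length))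
        ((α + n.length + m.length + 1) * ((m'.length : ℝ) + n'.length)) x *
        wronskianDet ((seedIndices n m m' n').map (seedFn α lam)) x := by
  have h1 : ∀ k, expPowLaguerre 0 0 1 k α = fun x => ((laguerreL k α x : ℝ) : ℂ) := by
    intro k; ext x; simp [expPowLaguerre]
  have h2 : ∀ k, expPowLaguerre 1 0 (-1) k α =
      fun x => ((Real.exp x * laguerreL k α (-x) : ℝ) : ℂ) := by
    intro k; ext x; simp [expPowLaguerre]
  have h3 : ∀ k, expPowLaguerre 0 (-α) 1 k (-α) =
      fun x => ((x ^ (-α) * laguerreL k (-α) x : ℝ) : ℂ) := by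
    intro k; ext x; simp [expPowLaguerre]
  have h4 : ∀ k, expPowLaguerre 1 (-α) (-1) k (-α) =
      fun x => ((Real.exp x * x ^ (-α) * laguerreL k (-α) (-x) : ℝ) : ℂ) := by
    intro k; ext x; simp [expPowLaguerre]
  simp only [omegaFirst, expPow, seedFunctions, seedIndices, seedFn, List.map_append, List.map_map,
    List.map_cons, List.map_nil, Function.comp_def, h1, h2, h3, h4]

theorem complex_ne_neg_natCast {a : ℝ} (h : ∀ k : ℕ, a ≠ -(k : ℝ)) (k : ℕ) :
    (a : ℂ) ≠ -(k : ℂ) := by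
  exact_mod_cast h k

theorem complex_add_one_ne_neg_natCast {a : ℝ} (h : ∀ k : ℕ, a + 1 ≠ -(k : ℝ)) (k : ℕ) :
    (a : ℂ) + 1 ≠ -(k : ℂ) := by
  exact_mod_cast h k

/-- Raise the degree of the labels `laguerre k` by one. -/
def SeedIndex.succLaguerre : SeedIndex → SeedIndex
  | .laguerre k => .laguerre (k + 1)
  | j => j

/-- Raise the degree of the labels `expLaguerre k` by one. -/
def SeedIndex.succExpLaguerre : SeedIndex → SeedIndex
  | .expLaguerre k => .expLaguerre (k + 1)
  | j => j

/-- Raise the degree of the labels `powLaguerre k` by one. -/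
def SeedIndex.succPowLaguerre : SeedIndex → SeedIndex
  | .powLaguerre k => .powLaguerre (k + 1)
  | j => j

/-- Raise the degree of the labels `expPowLaguerre k` by one. -/
def SeedIndex.succExpPowLaguerre : SeedIndex → SeedIndex
  | .expPowLaguerre k => .expPowLaguerre (k + 1)
  | j => j

/-- A family of constants indexed by the labels. -/
def SeedIndex.elim (c₁ c₂ c₃ c₄ : ℕ → ℂ) (c₅ : ℂ) : SeedIndex → ℂ
  | .laguerre k => c₁ k
  | .expLaguerre k => c₂ k
  | .powLaguerre k => c₃ k
  | .expPowLaguerre k => c₄ k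
  | .kummer => c₅

theorem prod_map_elim_seedIndices (n m m' n' : List ℕ) (c₁ c₂ c₃ c₄ : ℕ → ℂ) (c₅ : ℂ) :
    ((seedIndices n m m' n').map (SeedIndex.elim c₁ c₂ c₃ c₄ c₅)).prod =
      (n.map c₁).prod * (m.map c₂).prod * (m'.map c₃).prod * (n'.map c₄).prod * c₅ := by
  simp [seedIndices, Function.comp_def, SeedIndex.elim, mul_assoc]

/-- Common core of the four removals. The labels j are neutral: `s` raises the degrees in the family
of the removed function, as they stand before division, and `s'` raises those in the conjugate
family, as they stand afterwards. With r remaining seeds there are also h and g, hence r + 2 factors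
of g and r + 1 of the gauge factor of the derivatives. -/
theorem seedFn_gauge {s s' : SeedIndex → SeedIndex} {c₁ c₂ c₃ c₄ : ℕ → ℂ} {c₅ : ℂ}
    {E Q E' Q' α α' : ℝ} {lam lam' : ℂ} {x : ℝ} (hx : 0 < x) (hα : ∀ k : ℕ, α + 1 ≠ -(k : ℝ))
    (hα' : ∀ k : ℕ, α' + 1 ≠ -(k : ℝ)) {i : SeedIndex} (hi : seedFn α lam i = expPow E Q)
    (h : ∀ j, deriv (fun y => seedFn α lam (s j) y / expPow E Q y) =ᶠ[𝓝 x] fun y =>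
      SeedIndex.elim c₁ c₂ c₃ c₄ c₅ j * (expPow E' Q' y * seedFn α' lam' (s' j) y))
    {A B : List SeedIndex} {n m m' n' : List ℕ} (hAB : A ++ B = seedIndices n m m' n') :
    wronskianDet ((A.map s ++ i :: B.map s).map (seedFn α lam)) x =
      (-1) ^ A.length * ((n.map c₁).prod * (m.map c₂).prod * (m'.map c₃).prod *
          (n'.map c₄).prod * c₅)
        * (expPow ((n.length + m.length + m'.length + n'.length + 2) * E
            + (n.length + m.length + m'.length + n'.length + 1) * E')
          ((n.length + m.length + m'.length + n'.length + 2) * Q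
            + (n.length + m.length + m'.length + n'.length + 1) * Q') x
        * wronskianDet (((seedIndices n m m' n').map s').map (seedFn α' lam')) x) := by
  have key := wronskianDet_append_cons (A := A) (B := B) (f := fun j => seedFn α lam (s j))
    (F := fun j => seedFn α' lam' (s' j)) (c := SeedIndex.elim c₁ c₂ c₃ c₄ c₅)
    (expPow_contDiffAt hx E Q) (expPow_ne_zero hx E Q) (expPow_contDiffAt hx E' Q')
    (fun j _ => seedFn_contDiffAt lam (complex_add_one_ne_neg_natCast hα) hx _)
    (fun j _ => seedFn_contDiffAt lam' (complex_add_one_ne_neg_natCast hα') hx _)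
    (fun j _ => h j)
  have e1 : (A.map s ++ i :: B.map s).map (seedFn α lam) =
      A.map (fun j => seedFn α lam (s j)) ++ expPow E Q :: B.map (fun j => seedFn α lam (s j)) := by
    simp [hi, Function.comp_def]
  have e2 : (A ++ B).length = n.length + m.length + m'.length + n'.length + 1 := by
    simp [hAB, seedIndices]; omega
  rw [e1, key, expPow_pow hx, expPow_pow hx, mul_assoc _ (expPow _ _ x) (expPow _ _ x),
    expPow_mul hx, List.map_map, e2, hAB, prod_map_elim_seedIndices]
  push_cast
  rw [add_assoc _ (1 : ℝ) 1, one_add_one_eq_two]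
  simp only [Function.comp_def]
  ring

theorem expPow_mul_mul {x : ℝ} (hx : 0 < x) {E Q E' Q' E'' Q'' : ℝ} (hE : E + E' = E'')
    (hQ : Q + Q' = Q'') (C W : ℂ) :
    expPow E Q x * (C * (expPow E' Q' x * W)) = C * (expPow E'' Q'' x * W) := by
  rw [← hE, ← hQ, ← expPow_mul hx]
  ring

/-! ### Removal of a seed function of degree zero -/

/-- Removal of the seed function `L_0^α = 1`. -/
theorem omegaFirst_laguerre_zero (n m m' n' : List ℕ) {α : ℝ} (lam : ℂ) {x : ℝ} (hx : 0 < x)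
    (hα : ∀ k : ℕ, α + 1 ≠ -(k : ℝ)) :
    omegaFirst (n.map Nat.succ ++ [0]) m m' n' α lam x =
      (-1) ^ (n.length + n.length) * (m'.map fun k : ℕ => (k : ℂ) - α).prod
        * (n'.map fun k : ℕ => (k : ℂ) + 1).prod * (-lam / (α + 1))
        * omegaFirst n m m' (n'.map Nat.succ) (α + 1) (lam - 1) x := by
  have hα' : ∀ k : ℕ, α + 1 + 1 ≠ -(k : ℝ) := fun k h => hα (k + 1) (by push_cast; linarith)
  have h0 : seedFn α lam (SeedIndex.laguerre 0) = expPow 0 0 := by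
    ext y; simp [seedFn, expPowLaguerre, expPow, laguerreL_zero]
  have e1 : seedIndices (n.map Nat.succ ++ [0]) m m' n' =
      (n.map SeedIndex.laguerre).map SeedIndex.succLaguerre ++ SeedIndex.laguerre 0 ::
        (m.map SeedIndex.expLaguerre ++ m'.map SeedIndex.powLaguerre ++
          n'.map SeedIndex.expPowLaguerre ++ [SeedIndex.kummer]).map SeedIndex.succLaguerre := by
    simp [seedIndices, SeedIndex.succLaguerre, Function.comp_def]
  have e2 : (seedIndices n m m' n').map SeedIndex.succExpPowLaguerre =
      seedIndices n m m' (n'.map Nat.succ) := by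
    simp [seedIndices, SeedIndex.succExpPowLaguerre, Function.comp_def]
  rw [omegaFirst_eq, omegaFirst_eq, e1, seedFn_gauge (s' := SeedIndex.succExpPowLaguerre)
    (c₁ := fun _ => ((-1 : ℝ) : ℂ))
    (c₂ := fun _ => ((1 : ℝ) : ℂ))
    (c₃ := fun k => ((k - α : ℝ) : ℂ))
    (c₄ := fun k => ((k + 1 : ℝ) : ℂ))
    (c₅ := -lam / (α + 1)) (E' := 0) (Q' := 0) (α' := α + 1) (lam' := lam - 1) hx hα hα' h0
    ?_ (n := n) (m := m) (m' := m') (n' := n') (by simp [seedIndices]), e2]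
  · simp only [List.length_append, List.length_map, List.length_cons, List.length_nil]
    push_cast
    -- The prefactor of Ω times the extracted powers of g and of the gauge factor is exactly the
    -- prefactor of the new Ω, with α + 1 for α; the other removals balance in the same way.
    rw [expPow_mul_mul hx (E'' := -((m.length : ℝ) + n'.length))
      (Q'' := (α + 1 + n.length + m.length + 1) * ((m'.length : ℝ) + n'.length))
      (by ring) (by ring)]
    simp only [List.map_const', List.prod_replicate, pow_add, one_pow]
    ring
  · intro j
    cases j with
    | laguerre k =>
      refine deriv_expPowLaguerre_div hx 1 (by ring) (by ring) fun y _ => ?_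
      rw [deriv_laguerreL_succ, Real.rpow_one]; ring
    | expLaguerre k =>
      refine deriv_expPowLaguerre_div hx 1 (by ring) (by ring) fun y _ => ?_
      rw [← laguerreL_sub_deriv, Real.rpow_one]; ring
    | powLaguerre k =>
      refine deriv_expPowLaguerre_div hx 0 (by ring) (by ring) fun y _ => ?_
      have := mul_deriv_laguerreL_add k (-α) (1 * y)
      rw [Real.rpow_zero, neg_add']; linear_combination this
    | expPowLaguerre k =>
      refine deriv_expPowLaguerre_div hx 0 (by ring) (by ring) fun y _ => ?_
      have := mul_deriv_laguerreL_add_sub k (-α) (-1 * y)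
      rw [Real.rpow_zero, neg_add']; linear_combination this
    | kummer =>
      refine deriv_hFirst_div hx 1 (complex_add_one_ne_neg_natCast hα) (by ring) (by ring)
        fun y _ => ?_
      rw [deriv_kummerM _ (complex_add_one_ne_neg_natCast hα)]
      simp only [hFirst, SeedIndex.elim, Real.rpow_one]
      push_cast
      rw [neg_sub', sub_neg_eq_add]
      ring

/-- Removal of the seed function `e^x x^{-α} L_0^{-α}(-x) = e^x x^{-α}`. -/
theorem omegaFirst_expPowLaguerre_zero (n m m' n' : List ℕ) {α : ℝ} (lam : ℂ) {x : ℝ} (hx : 0 < x)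
    (hα : ∀ k : ℕ, α + 1 ≠ -(k : ℝ)) (hα₀ : ∀ k : ℕ, α ≠ -(k : ℝ)) :
    omegaFirst n m m' (n'.map Nat.succ ++ [0]) α lam x =
      (-1) ^ (n.length + m.length + m'.length + n'.length + m'.length) *
          (n.map fun k : ℕ => (k : ℂ) + 1).prod
        * (m.map fun k : ℕ => (k : ℂ) + α).prod * α
        * omegaFirst (n.map Nat.succ) m m' n' (α - 1) (lam + 1) x := by
  have hα' : ∀ k : ℕ, α - 1 + 1 ≠ -(k : ℝ) := by simpa using hα₀
  have h0 : seedFn α lam (SeedIndex.expPowLaguerre 0) = expPow 1 (-α) := by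
    ext y; simp [seedFn, expPowLaguerre, expPow, laguerreL_zero]
  have e1 : seedIndices n m m' (n'.map Nat.succ ++ [0]) =
      (n.map SeedIndex.laguerre ++ m.map SeedIndex.expLaguerre ++
        m'.map SeedIndex.powLaguerre ++ n'.map
        SeedIndex.expPowLaguerre).map SeedIndex.succExpPowLaguerre ++
        SeedIndex.expPowLaguerre 0 ::
        [SeedIndex.kummer].map SeedIndex.succExpPowLaguerre := by
    simp [seedIndices, SeedIndex.succExpPowLaguerre, Function.comp_def]
  have e2 : (seedIndices n m m' n').map SeedIndex.succLaguerre =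
      seedIndices (n.map Nat.succ) m m' n' := by
    simp [seedIndices, SeedIndex.succLaguerre, Function.comp_def]
  rw [omegaFirst_eq, omegaFirst_eq, e1, seedFn_gauge (s' := SeedIndex.succLaguerre)
    (c₁ := fun k => ((k + 1 : ℝ) : ℂ))
    (c₂ := fun k => ((k + α : ℝ) : ℂ))
    (c₃ := fun _ => ((-1 : ℝ) : ℂ))
    (c₄ := fun _ => ((1 : ℝ) : ℂ))
    (c₅ := α) (E' := -1) (Q' := α - 1) (α' := α - 1) (lam' := lam + 1) hx hα hα' h0
    ?_ (n := n) (m := m) (m' := m') (n' := n') (by simp [seedIndices]), e2]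
  · simp only [List.length_append, List.length_map, List.length_cons, List.length_nil]
    push_cast
    rw [expPow_mul_mul hx (E'' := -((m.length : ℝ) + n'.length))
      (Q'' := (α - 1 + n.length + m.length + 1) * ((m'.length : ℝ) + n'.length))
      (by ring) (by ring)]
    simp only [List.map_const', List.prod_replicate, pow_add, one_pow]
    ring
  · intro j
    cases j with
    | laguerre k =>
      refine deriv_expPowLaguerre_div hx 0 (by ring) (by ring) fun y _ => ?_
      have := mul_deriv_laguerreL_add_sub k α (1 * y)
      rw [Real.rpow_zero]; linear_combination this
    | expLaguerre k =>
      refine deriv_expPowLaguerre_div hx 0 (by ring) (by ring) fun y _ => ?_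
      have := mul_deriv_laguerreL_add k α (-1 * y)
      rw [Real.rpow_zero]; linear_combination this
    | powLaguerre k =>
      refine deriv_expPowLaguerre_div hx 1 (by ring) (by ring) fun y _ => ?_
      rw [show -(α - 1) = -α + 1 by ring, ← laguerreL_sub_deriv, Real.rpow_one]; ring
    | expPowLaguerre k =>
      refine deriv_expPowLaguerre_div hx 1 (by ring) (by ring) fun y _ => ?_
      rw [show -(α - 1) = -α + 1 by ring, deriv_laguerreL_succ, Real.rpow_one]; ring
    | kummer =>
      refine deriv_hFirst_div hx 0 (complex_add_one_ne_neg_natCast hα) (by ring) (by ring)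
        fun y _ => ?_
      have := mul_deriv_kummerM_add_sub (-lam) (complex_ne_neg_natCast hα₀) y
      simp only [hFirst, SeedIndex.elim, Real.rpow_zero]
      push_cast
      rw [neg_add', sub_add_cancel]
      linear_combination this

/-- Removal of the seed function `e^x L_0^α(-x) = e^x`. -/
theorem omegaFirst_expLaguerre_zero (n m m' n' : List ℕ) {α : ℝ} (lam : ℂ) {x : ℝ} (hx : 0 < x)
    (hα : ∀ k : ℕ, α + 1 ≠ -(k : ℝ)) :
    omegaFirst n (m.map Nat.succ ++ [0]) m' n' α lam x =
      (-1) ^ (n.length + m.length + n.length) * (m'.map fun k : ℕ => (k : ℂ) + 1).prod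
        * (n'.map fun k : ℕ => (k : ℂ) - α).prod * (-(lam + α + 1) / (α + 1))
        * omegaFirst n m (m'.map Nat.succ) n' (α + 1) lam x := by
  have hα' : ∀ k : ℕ, α + 1 + 1 ≠ -(k : ℝ) := fun k h => hα (k + 1) (by push_cast; linarith)
  have h0 : seedFn α lam (SeedIndex.expLaguerre 0) = expPow 1 0 := by
    ext y; simp [seedFn, expPowLaguerre, expPow, laguerreL_zero]
  have e1 : seedIndices n (m.map Nat.succ ++ [0]) m' n' =
      (n.map SeedIndex.laguerre ++ m.map SeedIndex.expLaguerre).map SeedIndex.succExpLaguerre ++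
        SeedIndex.expLaguerre 0 ::
        (m'.map SeedIndex.powLaguerre ++
          n'.map SeedIndex.expPowLaguerre ++ [SeedIndex.kummer]).map SeedIndex.succExpLaguerre := by
    simp [seedIndices, SeedIndex.succExpLaguerre, Function.comp_def]
  have e2 : (seedIndices n m m' n').map SeedIndex.succPowLaguerre =
      seedIndices n m (m'.map Nat.succ) n' := by
    simp [seedIndices, SeedIndex.succPowLaguerre, Function.comp_def]
  rw [omegaFirst_eq, omegaFirst_eq, e1, seedFn_gauge (s' := SeedIndex.succPowLaguerre)
    (c₁ := fun _ => ((-1 : ℝ) : ℂ))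
    (c₂ := fun _ => ((1 : ℝ) : ℂ))
    (c₃ := fun k => ((k + 1 : ℝ) : ℂ))
    (c₄ := fun k => ((k - α : ℝ) : ℂ))
    (c₅ := -(lam + α + 1) / (α + 1)) (E' := (-1)) (Q' := 0) (α' := α + 1) (lam' := lam) hx hα hα' h0
    ?_ (n := n) (m := m) (m' := m') (n' := n') (by simp [seedIndices]), e2]
  · simp only [List.length_append, List.length_map, List.length_cons, List.length_nil]
    push_cast
    rw [expPow_mul_mul hx (E'' := -((m.length : ℝ) + n'.length))
      (Q'' := (α + 1 + n.length + m.length + 1) * ((m'.length : ℝ) + n'.length))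
      (by ring) (by ring)]
    simp only [List.map_const', List.prod_replicate, pow_add, one_pow]
    ring
  · intro j
    cases j with
    | laguerre k =>
      refine deriv_expPowLaguerre_div hx 1 (by ring) (by ring) fun y _ => ?_
      rw [← laguerreL_sub_deriv, Real.rpow_one]; ring
    | expLaguerre k =>
      refine deriv_expPowLaguerre_div hx 1 (by ring) (by ring) fun y _ => ?_
      rw [deriv_laguerreL_succ, Real.rpow_one]; ring
    | powLaguerre k =>
      refine deriv_expPowLaguerre_div hx 0 (by ring) (by ring) fun y _ => ?_
      have := mul_deriv_laguerreL_add_sub k (-α) (1 * y)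
      rw [Real.rpow_zero, neg_add']; linear_combination this
    | expPowLaguerre k =>
      refine deriv_expPowLaguerre_div hx 0 (by ring) (by ring) fun y _ => ?_
      have := mul_deriv_laguerreL_add k (-α) (-1 * y)
      rw [Real.rpow_zero, neg_add']; linear_combination this
    | kummer =>
      refine deriv_hFirst_div hx 1 (complex_add_one_ne_neg_natCast hα) (by ring) (by ring)
        fun y _ => ?_
      have := kummerM_sub_deriv (-lam) (complex_add_one_ne_neg_natCast hα) y
      simp only [hFirst, SeedIndex.elim, Real.rpow_one]
      push_cast
      linear_combination (y : ℂ) * this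

/-- Removal of the seed function `x^{-α} L_0^{-α}(x) = x^{-α}`. -/
theorem omegaFirst_powLaguerre_zero (n m m' n' : List ℕ) {α : ℝ} (lam : ℂ) {x : ℝ} (hx : 0 < x)
    (hα : ∀ k : ℕ, α + 1 ≠ -(k : ℝ)) (hα₀ : ∀ k : ℕ, α ≠ -(k : ℝ)) :
    omegaFirst n m (m'.map Nat.succ ++ [0]) n' α lam x =
      (-1) ^ (n.length + m.length + m'.length + m'.length) * (n.map fun k : ℕ => (k : ℂ) + α).prod
        * (m.map fun k : ℕ => (k : ℂ) + 1).prod * α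
        * omegaFirst n (m.map Nat.succ) m' n' (α - 1) lam x := by
  have hα' : ∀ k : ℕ, α - 1 + 1 ≠ -(k : ℝ) := by simpa using hα₀
  have h0 : seedFn α lam (SeedIndex.powLaguerre 0) = expPow 0 (-α) := by
    ext y; simp [seedFn, expPowLaguerre, expPow, laguerreL_zero]
  have e1 : seedIndices n m (m'.map Nat.succ ++ [0]) n' =
      (n.map SeedIndex.laguerre ++ m.map SeedIndex.expLaguerre ++
        m'.map SeedIndex.powLaguerre).map SeedIndex.succPowLaguerre ++ SeedIndex.powLaguerre 0 ::
        (n'.map SeedIndex.expPowLaguerre ++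
          [SeedIndex.kummer]).map SeedIndex.succPowLaguerre := by
    simp [seedIndices, SeedIndex.succPowLaguerre, Function.comp_def]
  have e2 : (seedIndices n m m' n').map SeedIndex.succExpLaguerre =
      seedIndices n (m.map Nat.succ) m' n' := by
    simp [seedIndices, SeedIndex.succExpLaguerre, Function.comp_def]
  rw [omegaFirst_eq, omegaFirst_eq, e1, seedFn_gauge (s' := SeedIndex.succExpLaguerre)
    (c₁ := fun k => ((k + α : ℝ) : ℂ))
    (c₂ := fun k => ((k + 1 : ℝ) : ℂ))
    (c₃ := fun _ => ((-1 : ℝ) : ℂ))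
    (c₄ := fun _ => ((1 : ℝ) : ℂ))
    (c₅ := α) (E' := 0) (Q' := α - 1) (α' := α - 1) (lam' := lam) hx hα hα' h0
    ?_ (n := n) (m := m) (m' := m') (n' := n') (by simp [seedIndices]), e2]
  · simp only [List.length_append, List.length_map, List.length_cons, List.length_nil]
    push_cast
    rw [expPow_mul_mul hx (E'' := -((m.length : ℝ) + n'.length))
      (Q'' := (α - 1 + n.length + m.length + 1) * ((m'.length : ℝ) + n'.length))
      (by ring) (by ring)]
    simp only [List.map_const', List.prod_replicate, pow_add, one_pow]
    ring
  · intro j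
    cases j with
    | laguerre k =>
      refine deriv_expPowLaguerre_div hx 0 (by ring) (by ring) fun y _ => ?_
      have := mul_deriv_laguerreL_add k α (1 * y)
      rw [Real.rpow_zero]; linear_combination this
    | expLaguerre k =>
      refine deriv_expPowLaguerre_div hx 0 (by ring) (by ring) fun y _ => ?_
      have := mul_deriv_laguerreL_add_sub k α (-1 * y)
      rw [Real.rpow_zero]; linear_combination this
    | powLaguerre k =>
      refine deriv_expPowLaguerre_div hx 1 (by ring) (by ring) fun y _ => ?_
      rw [show -(α - 1) = -α + 1 by ring, deriv_laguerreL_succ, Real.rpow_one]; ring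
    | expPowLaguerre k =>
      refine deriv_expPowLaguerre_div hx 1 (by ring) (by ring) fun y _ => ?_
      rw [show -(α - 1) = -α + 1 by ring, ← laguerreL_sub_deriv, Real.rpow_one]; ring
    | kummer =>
      refine deriv_hFirst_div hx 0 (complex_add_one_ne_neg_natCast hα) (by ring) (by ring)
        fun y _ => ?_
      have := mul_deriv_kummerM_add (-lam) (complex_ne_neg_natCast hα₀) y
      simp only [hFirst, SeedIndex.elim, Real.rpow_zero]
      push_cast
      rw [sub_add_cancel]
      linear_combination this

/-! ### Encodings of Maya diagrams under a unit shift -/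

theorem sort_eq_of_pairwise {s : Finset ℕ} {l : List ℕ} (hl : l.Pairwise (· > ·))
    (h : ∀ k, k ∈ l ↔ k ∈ s) : s.sort (fun a b => b ≤ a) = l := by
  have h1 : l.toFinset = s := by ext k; simp [h]
  have h2 : l.Nodup := hl.imp fun h => ne_of_gt h
  rw [← h1]
  exact (List.toFinset_sort (fun a b : ℕ => b ≤ a) h2).2 (hl.imp fun h => le_of_lt h)

theorem prod_map_sort (s : Finset ℕ) (f : ℕ → ℂ) :
    ((s.sort fun a b => b ≤ a).map f).prod = ∏ k ∈ s, f k := by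
  rw [Finset.prod_eq_multiset_prod, ← Multiset.prod_coe, ← Multiset.map_coe, Finset.sort_eq]

/-- Each later entry is a distinct smaller natural number, so the entry at position i is at least
length - 1 - i. This keeps the subtraction in `partition` from truncating. -/
theorem length_le_getElem_add {l : List ℕ} (hl : l.Pairwise (· > ·)) (i : ℕ) (hi : i < l.length) :
    l.length ≤ l[i] + (i + 1) := by
  induction l generalizing i with
  | nil => simp at hi
  | cons a l ih =>
    rw [List.pairwise_cons] at hl
    cases i with
    | zero =>
      cases l with
      | nil => simp
      | cons b l =>
        have h1 := ih hl.2 0 (by simp)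
        have h2 := hl.1 b (by simp)
        simp at h1 h2 ⊢
        omega
    | succ i =>
      have := ih hl.2 i (by simpa using hi)
      simp
      omega

namespace MayaDiagram

theorem eq_of_carrier_eq {M N : MayaDiagram} (h : M.carrier = N.carrier) : M = N := by
  cases M; cases N; simp at h; subst h; rfl

theorem mem_shift {M : MayaDiagram} {t k : ℤ} : k ∈ (M.shift t).carrier ↔ k - t ∈ M.carrier :=
  Iff.rfl

theorem shift_shift (M : MayaDiagram) (s t : ℤ) : (M.shift s).shift t = M.shift (s + t) := by
  refine eq_of_carrier_eq (Set.ext fun k => ?_)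
  rw [mem_shift, mem_shift, mem_shift, sub_sub, add_comm t s]

theorem shift_zero (M : MayaDiagram) : M.shift 0 = M :=
  eq_of_carrier_eq (Set.ext fun k => by rw [mem_shift, sub_zero])

theorem mem_rightSet {M : MayaDiagram} {n : ℕ} : n ∈ M.rightSet ↔ (n : ℤ) ∈ M.carrier := by
  simp [rightSet]

theorem mem_leftSet {M : MayaDiagram} {n : ℕ} : n ∈ M.leftSet ↔ -(n : ℤ) - 1 ∉ M.carrier := by
  simp [leftSet]

theorem mem_left {M : MayaDiagram} {n : ℕ} : n ∈ M.left ↔ n ∈ M.leftSet := by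
  simp [left]

theorem pairwise_right (M : MayaDiagram) : M.right.Pairwise (· > ·) :=
  (M.rightSet.sortedGT_sort).pairwise

theorem pairwise_left (M : MayaDiagram) : M.left.Pairwise (· > ·) :=
  (M.leftSet.sortedGT_sort).pairwise

theorem prod_map_right (M : MayaDiagram) (f : ℕ → ℂ) :
    (M.right.map f).prod = ∏ k ∈ M.rightSet, f k := prod_map_sort _ f

theorem prod_map_left (M : MayaDiagram) (f : ℕ → ℂ) :
    (M.left.map f).prod = ∏ k ∈ M.leftSet, f k := prod_map_sort _ f

theorem zero_mem_rightSet_shift {M : MayaDiagram} :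
    0 ∈ (M.shift 1).rightSet ↔ (-1 : ℤ) ∈ M.carrier := by
  simp [mem_rightSet, mem_shift]

theorem succ_mem_rightSet_shift {M : MayaDiagram} {k : ℕ} :
    k + 1 ∈ (M.shift 1).rightSet ↔ k ∈ M.rightSet := by
  simp [mem_rightSet, mem_shift]

theorem zero_mem_leftSet {M : MayaDiagram} : 0 ∈ M.leftSet ↔ (-1 : ℤ) ∉ M.carrier := by
  simp [mem_leftSet]

theorem mem_leftSet_shift {M : MayaDiagram} {k : ℕ} :
    k ∈ (M.shift 1).leftSet ↔ k + 1 ∈ M.leftSet := by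
  rw [mem_leftSet, mem_leftSet, mem_shift]
  push_cast
  rw [neg_add']

theorem pairwise_map_succ {l : List ℕ} (hl : l.Pairwise (· > ·)) :
    (l.map Nat.succ).Pairwise (· > ·) :=
  List.pairwise_map.2 (hl.imp fun h => Nat.succ_lt_succ h)

theorem pairwise_map_succ_append_zero {l : List ℕ} (hl : l.Pairwise (· > ·)) :
    (l.map Nat.succ ++ [0]).Pairwise (· > ·) :=
  List.pairwise_append.2 ⟨pairwise_map_succ hl, by simp, by simp⟩

/-- The box -1 lands on 0 and becomes the last entry of the decreasing list. Every unit shift either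
creates a right entry 0 in this way or deletes a left entry 0 (`left_of_notMem`). -/
theorem right_shift_of_mem {M : MayaDiagram} (h : (-1 : ℤ) ∈ M.carrier) :
    (M.shift 1).right = M.right.map Nat.succ ++ [0] := by
  refine sort_eq_of_pairwise (pairwise_map_succ_append_zero M.pairwise_right) fun k => ?_
  cases k with
  | zero => simp [zero_mem_rightSet_shift, h]
  | succ k => simp [succ_mem_rightSet_shift, right]

theorem right_shift_of_notMem {M : MayaDiagram} (h : (-1 : ℤ) ∉ M.carrier) :
    (M.shift 1).right = M.right.map Nat.succ := by
  refine sort_eq_of_pairwise (pairwise_map_succ M.pairwise_right) fun k => ?_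
  cases k with
  | zero => simp [zero_mem_rightSet_shift, h]
  | succ k => simp [succ_mem_rightSet_shift, right]

theorem left_of_mem {M : MayaDiagram} (h : (-1 : ℤ) ∈ M.carrier) :
    M.left = (M.shift 1).left.map Nat.succ := by
  refine sort_eq_of_pairwise (pairwise_map_succ (pairwise_left _)) fun k => ?_
  cases k with
  | zero => simp [zero_mem_leftSet, h]
  | succ k => simp [mem_left, mem_leftSet_shift]

theorem left_of_notMem {M : MayaDiagram} (h : (-1 : ℤ) ∉ M.carrier) :
    M.left = (M.shift 1).left.map Nat.succ ++ [0] := by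
  refine sort_eq_of_pairwise (pairwise_map_succ_append_zero (pairwise_left _)) fun k => ?_
  cases k with
  | zero => simp [zero_mem_leftSet, h]
  | succ k => simp [mem_left, mem_leftSet_shift]

theorem prod_rightSet_shift_of_mem {M : MayaDiagram} (h : (-1 : ℤ) ∈ M.carrier) (f : ℕ → ℂ) :
    ∏ k ∈ (M.shift 1).rightSet, f k = (∏ k ∈ M.rightSet, f (k + 1)) * f 0 := by
  rw [← prod_map_right, ← prod_map_right, right_shift_of_mem h]
  simp [Function.comp_def]

theorem prod_rightSet_shift_of_notMem {M : MayaDiagram} (h : (-1 : ℤ) ∉ M.carrier) (f : ℕ → ℂ) :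
    ∏ k ∈ (M.shift 1).rightSet, f k = ∏ k ∈ M.rightSet, f (k + 1) := by
  rw [← prod_map_right, ← prod_map_right, right_shift_of_notMem h]
  simp [Function.comp_def]

theorem prod_leftSet_of_mem {M : MayaDiagram} (h : (-1 : ℤ) ∈ M.carrier) (f : ℕ → ℂ) :
    ∏ k ∈ M.leftSet, f k = ∏ k ∈ (M.shift 1).leftSet, f (k + 1) := by
  rw [← prod_map_left, ← prod_map_left, left_of_mem h]
  simp [Function.comp_def]

theorem prod_leftSet_of_notMem {M : MayaDiagram} (h : (-1 : ℤ) ∉ M.carrier) (f : ℕ → ℂ) :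
    ∏ k ∈ M.leftSet, f k = (∏ k ∈ (M.shift 1).leftSet, f (k + 1)) * f 0 := by
  rw [← prod_map_left, ← prod_map_left, left_of_notMem h]
  simp [Function.comp_def]

theorem prod_range_succ_sdiff_leftSet (M : MayaDiagram) (t : ℕ) (f : ℕ → ℂ)
    [Decidable ((-1 : ℤ) ∈ M.carrier)] :
    ∏ k ∈ Finset.range (t + 1) \ M.leftSet, f k =
      (∏ k ∈ Finset.range t \ (M.shift 1).leftSet, f (k + 1)) *
        if (-1 : ℤ) ∈ M.carrier then f 0 else 1 := by
  simp only [Finset.sdiff_eq_filter, Finset.prod_filter, Finset.prod_range_succ',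
    mem_leftSet_shift, zero_mem_leftSet, not_not]

/-- The shift must carry the empty box -k - 1 to a non-negative position. -/
theorem lt_of_mem_leftSet {M : MayaDiagram} {t : ℤ} (h : (M.shift t).IsCanonical) {k : ℕ}
    (hk : k ∈ M.leftSet) : (k : ℤ) < t := by
  by_contra! hkt
  refine mem_leftSet.1 hk ?_
  have := h.1 (-(k : ℤ) - 1 + t) (by omega)
  rwa [mem_shift, add_sub_cancel_right] at this

theorem zero_mem_of_isCanonical_shift_neg {M : MayaDiagram} {t : ℤ} (h : (M.shift t).IsCanonical)
    (ht : t < 0) : (0 : ℤ) ∈ M.carrier := by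
  have := h.1 t ht
  rwa [mem_shift, sub_self] at this

theorem leftSet_eq_empty {M : MayaDiagram} (h : M.IsCanonical) : M.leftSet = ∅ := by
  ext k
  simp [mem_leftSet, h.1 (-(k : ℤ) - 1) (by omega)]

theorem partitionDegrees_partition (M : MayaDiagram) : partitionDegrees M.partition = M.right := by
  refine List.ext_getElem (by simp [partitionDegrees, partition]) fun i h1 h2 => ?_
  have := length_le_getElem_add M.pairwise_right i h2
  simp [partitionDegrees, partition]
  omega

end MayaDiagram

theorem omegaMaya_of_isCanonical {M₁ M₂ : MayaDiagram} (h₁ : M₁.IsCanonical) (h₂ : M₂.IsCanonical)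
    (α : ℝ) (lam : ℂ) (x : ℝ) :
    omegaMaya M₁ M₂ α lam x = omegaPartition M₁.partition M₂.partition α lam x := by
  simp [omegaMaya, omegaPartition, MayaDiagram.partitionDegrees_partition, MayaDiagram.left,
    MayaDiagram.leftSet_eq_empty h₁, MayaDiagram.leftSet_eq_empty h₂]

/-! ### Recursions of the constants -/

open MayaDiagram

theorem constC₃_swap (α : ℝ) (M₁ M₂ : MayaDiagram) : constC₃ α M₁ M₂ = constC₃ α M₂ M₁ := by
  unfold constC₃
  ring

theorem constC₃_of_isCanonical {M₁ M₂ : MayaDiagram} (h₁ : M₁.IsCanonical) (h₂ : M₂.IsCanonical)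
    (α : ℝ) : constC₃ α M₁ M₂ = 1 := by
  simp [constC₃, leftSet_eq_empty h₁, leftSet_eq_empty h₂]

/-- The new factors come from the new right entry 0. In all others the unit changes of entries and
of α cancel. -/
theorem constC₃_shift_of_mem {M₁ : MayaDiagram} (h : (-1 : ℤ) ∈ M₁.carrier) (M₂ : MayaDiagram)
    (α : ℝ) :
    constC₃ α (M₁.shift 1) M₂ = constC₃ (α + 1) M₁ M₂ *
      ((∏ k ∈ M₂.leftSet, ((k : ℂ) - α)) * ∏ k ∈ (M₁.shift 1).leftSet, ((k : ℂ) + 1)) := by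
  simp only [constC₃, prod_rightSet_shift_of_mem h, prod_leftSet_of_mem h]
  push_cast
  simp only [sub_zero, zero_add, add_sub_add_right_eq_sub, sub_sub, add_assoc, add_comm,
    add_left_comm]
  ring

/-- The left entry 0 gives factors 0 - α - m = -(m + α), whence the sign, and factors n + 1. -/
theorem constC₃_of_notMem {M₁ : MayaDiagram} (h : (-1 : ℤ) ∉ M₁.carrier) (M₂ : MayaDiagram)
    (α : ℝ) :
    constC₃ α M₁ M₂ = (-1) ^ M₂.rightSet.card * constC₃ (α - 1) (M₁.shift 1) M₂ *
      ((∏ k ∈ M₁.rightSet, ((k : ℂ) + 1)) * ∏ k ∈ M₂.rightSet, ((k : ℂ) + α)) := by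
  have e : ∏ k ∈ M₂.rightSet, ((0 : ℂ) - α - k) =
      (-1) ^ M₂.rightSet.card * ∏ k ∈ M₂.rightSet, ((k : ℂ) + α) := by
    rw [← Finset.prod_const, ← Finset.prod_mul_distrib]
    exact Finset.prod_congr rfl fun k _ => by ring
  have e1 : ∀ a b : ℂ, a + 1 - α - b = a - (α - 1) - b := fun a b => by ring
  have e2 : ∀ a b : ℂ, a - (α - 1) - (b + 1) = a - α - b := fun a b => by ring
  have e3 : ∀ a b : ℂ, a + (b + 1) + 1 = a + 1 + b + 1 := fun a b => by ring
  simp only [constC₃, prod_rightSet_shift_of_notMem h, prod_leftSet_of_notMem h]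
  push_cast
  simp only [Finset.prod_mul_distrib, e, e1, e2, e3, add_zero]
  ring

theorem falling_succ (z : ℂ) (n : ℕ) : falling z (n + 1) = z * falling (z - 1) n := by
  simp [falling, descPochhammer_succ_left]

theorem constC₁_natCast (α : ℝ) (lam : ℂ) (M : MayaDiagram) (t : ℕ) :
    constC₁ α lam M t =
      falling α t / ∏ k ∈ Finset.range t \ M.leftSet, (-lam - (k : ℂ) - 1) := by
  cases t with
  | zero => simp [constC₁, falling]
  | succ t =>
    rw [constC₁, if_neg (by omega), if_neg (by omega), Int.natAbs_natCast]

theorem constC₁_neg_natCast (α : ℝ) (lam : ℂ) (M : MayaDiagram) (t : ℕ) :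
    constC₁ α lam M (-t) = rising (-lam) t / rising ((α : ℂ) + 1) t := by
  cases t with
  | zero => simp [constC₁, rising]
  | succ t => rw [constC₁, if_pos (by omega), Int.natAbs_neg, Int.natAbs_natCast]

theorem constC₁_natCast_add_one_of_notMem {M : MayaDiagram} (h : (-1 : ℤ) ∉ M.carrier) (α : ℝ)
    (lam : ℂ) (t : ℕ) :
    constC₁ α lam M (t + 1) = α * constC₁ (α - 1) (lam + 1) (M.shift 1) t := by
  classical
  rw [← Nat.cast_succ, constC₁_natCast, constC₁_natCast, falling_succ,
    prod_range_succ_sdiff_leftSet, if_neg h, mul_one, mul_div_assoc]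
  push_cast
  simp only [neg_add', sub_sub, add_comm, add_left_comm]

theorem constC₁_natCast_add_one_of_mem {M : MayaDiagram} (h : (-1 : ℤ) ∈ M.carrier) (α : ℝ)
    (lam : ℂ) (t : ℕ) :
    constC₁ α lam M (t + 1) = α / (-lam - 1) * constC₁ (α - 1) (lam + 1) (M.shift 1) t := by
  classical
  rw [← Nat.cast_succ, constC₁_natCast, constC₁_natCast, falling_succ,
    prod_range_succ_sdiff_leftSet, if_pos h, mul_comm (∏ k ∈ _, _), mul_div_mul_comm]
  push_cast
  simp only [neg_add', sub_sub, add_comm, add_left_comm, zero_add]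

theorem constC₁_neg_natCast_sub_one (α : ℝ) (lam : ℂ) (M N : MayaDiagram) (t : ℕ) :
    constC₁ α lam M (-t - 1) = -lam / (α + 1) * constC₁ (α + 1) (lam - 1) N (-t) := by
  rw [← neg_add', ← Nat.cast_succ, constC₁_neg_natCast, constC₁_neg_natCast, rising_succ_left,
    rising_succ_left, mul_div_mul_comm]
  push_cast
  rw [neg_sub', sub_neg_eq_add]

/-- C₂ involves only α - t₁ and α + λ, so it is unaffected by the unit shifts of M₁. -/
theorem constC₂_add_one (α : ℝ) (lam : ℂ) (M : MayaDiagram) (t₁ t₂ : ℤ) :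
    constC₂ α lam M (t₁ + 1) t₂ = constC₂ (α - 1) (lam + 1) M t₁ t₂ := by
  unfold constC₂
  push_cast
  have e1 : (α : ℂ) - (t₁ + 1) = α - 1 - t₁ := by ring
  have e2 : lam + 1 + ((α : ℂ) - 1) = lam + α := by ring
  have e3 : (α : ℂ) - 1 + 1 + (lam + 1) = α + 1 + lam := by ring
  rw [e1, e2, e3]

/-- Canonicity matters at t = 0: it makes the product over `M.leftSet` empty, in agreement with the
value 1. -/
theorem constC₂_natCast {M : MayaDiagram} {t : ℕ} (h : (M.shift t).IsCanonical) (α : ℝ) (lam : ℂ) :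
    constC₂ α lam M 0 t = (∏ k ∈ Finset.range t \ M.leftSet, ((α : ℂ) - k))
      * (∏ k ∈ M.leftSet, ((α : ℂ) - k))
      / ∏ k ∈ Finset.range t \ M.leftSet, (lam + (α : ℂ) - (k : ℂ)) := by
  cases t with
  | zero =>
    have : M.leftSet = ∅ := by
      rw [Nat.cast_zero, shift_zero] at h
      exact leftSet_eq_empty h
    simp [constC₂, this]
  | succ t =>
    rw [constC₂, if_neg (by omega), if_neg (by omega), Int.natAbs_natCast, Int.cast_zero, sub_zero]

theorem constC₂_neg_natCast (α : ℝ) (lam : ℂ) (M : MayaDiagram) (t : ℕ) :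
    constC₂ α lam M 0 (-t) = rising ((α : ℂ) + 1 + lam) t / rising ((α : ℂ) + 1) t := by
  cases t with
  | zero => simp [constC₂, rising]
  | succ t =>
    rw [constC₂, if_pos (by omega), Int.natAbs_neg, Int.natAbs_natCast, Int.cast_zero, sub_zero]

theorem isCanonical_shift_one_shift {M : MayaDiagram} {t : ℤ} (h : (M.shift (t + 1)).IsCanonical) :
    ((M.shift 1).shift t).IsCanonical := by
  rwa [shift_shift, add_comm]

theorem constC₂_natCast_add_one_of_notMem {M : MayaDiagram} (h : (-1 : ℤ) ∉ M.carrier) (α : ℝ)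
    (lam : ℂ) {t : ℕ} (ht : (M.shift (t + 1)).IsCanonical) :
    constC₂ α lam M 0 (t + 1) = α * constC₂ (α - 1) lam (M.shift 1) 0 t := by
  classical
  rw [← Nat.cast_succ, constC₂_natCast (by exact_mod_cast ht),
    constC₂_natCast (isCanonical_shift_one_shift ht)]
  rw [prod_range_succ_sdiff_leftSet, prod_range_succ_sdiff_leftSet, if_neg h, if_neg h,
    prod_leftSet_of_notMem h]
  push_cast
  simp only [sub_sub, add_sub_assoc, add_comm (1 : ℂ), sub_zero]
  ring

theorem constC₂_natCast_add_one_of_mem {M : MayaDiagram} (h : (-1 : ℤ) ∈ M.carrier) (α : ℝ)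
    (lam : ℂ) {t : ℕ} (ht : (M.shift (t + 1)).IsCanonical) :
    constC₂ α lam M 0 (t + 1) = α / (lam + α) * constC₂ (α - 1) lam (M.shift 1) 0 t := by
  classical
  rw [← Nat.cast_succ, constC₂_natCast (by exact_mod_cast ht),
    constC₂_natCast (isCanonical_shift_one_shift ht)]
  rw [prod_range_succ_sdiff_leftSet, prod_range_succ_sdiff_leftSet, if_pos h, if_pos h,
    prod_leftSet_of_mem h]
  push_cast
  simp only [sub_sub, add_sub_assoc, add_comm (1 : ℂ), sub_zero]
  field_simp

theorem constC₂_neg_natCast_sub_one (α : ℝ) (lam : ℂ) (M N : MayaDiagram) (t : ℕ) :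
    constC₂ α lam M 0 (-t - 1) =
      (lam + α + 1) / (α + 1) * constC₂ (α + 1) lam N 0 (-t) := by
  rw [← neg_add', ← Nat.cast_succ, constC₂_neg_natCast, constC₂_neg_natCast, rising_succ_left,
    rising_succ_left, mul_div_mul_comm]
  push_cast
  ring_nf

/-! ### One-step relations for Ω -/

theorem omegaMaya_shift_left_of_mem {M₁ : MayaDiagram} (h : (-1 : ℤ) ∈ M₁.carrier)
    (M₂ : MayaDiagram) {α : ℝ} (lam : ℂ) (hα : ∀ k : ℕ, α + 1 ≠ -(k : ℝ)) {x : ℝ} (hx : 0 < x) :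
    omegaMaya (M₁.shift 1) M₂ α lam x =
      ((∏ k ∈ M₂.leftSet, ((k : ℂ) - α)) * ∏ k ∈ (M₁.shift 1).leftSet, ((k : ℂ) + 1))
        * (-lam / (α + 1)) * omegaMaya M₁ M₂ (α + 1) (lam - 1) x := by
  unfold omegaMaya
  rw [right_shift_of_mem h, omegaFirst_laguerre_zero _ _ _ _ lam hx hα, ← left_of_mem h,
    prod_map_left, prod_map_left, Even.neg_one_pow ⟨_, rfl⟩, one_mul]

theorem omegaMaya_left_of_notMem {M₁ : MayaDiagram} (h : (-1 : ℤ) ∉ M₁.carrier)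
    (M₂ : MayaDiagram) : ∃ d : ℕ, ∀ {α : ℝ} (lam : ℂ), (∀ k : ℕ, α + 1 ≠ -(k : ℝ)) →
      (∀ k : ℕ, α ≠ -(k : ℝ)) → ∀ {x : ℝ}, 0 < x → omegaMaya M₁ M₂ α lam x =
        (-1) ^ d * ((∏ k ∈ M₁.rightSet, ((k : ℂ) + 1)) * ∏ k ∈ M₂.rightSet, ((k : ℂ) + α))
          * α * omegaMaya (M₁.shift 1) M₂ (α - 1) (lam + 1) x := by
  refine ⟨M₁.right.length + M₂.right.length + M₂.left.length + (M₁.shift 1).left.length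
    + M₂.left.length, fun {α} lam hα hα' {x} hx => ?_⟩
  unfold omegaMaya
  rw [left_of_notMem h, omegaFirst_expPowLaguerre_zero _ _ _ _ lam hx hα hα',
    ← right_shift_of_notMem h, prod_map_right, prod_map_right, mul_assoc ((-1) ^ _)]

theorem omegaMaya_shift_right_of_mem {M₂ : MayaDiagram} (h : (-1 : ℤ) ∈ M₂.carrier)
    (M₁ : MayaDiagram) : ∃ d : ℕ, ∀ {α : ℝ} (lam : ℂ), (∀ k : ℕ, α + 1 ≠ -(k : ℝ)) →
      ∀ {x : ℝ}, 0 < x → omegaMaya M₁ (M₂.shift 1) α lam x =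
        (-1) ^ d * ((∏ k ∈ M₁.leftSet, ((k : ℂ) - α)) * ∏ k ∈ (M₂.shift 1).leftSet, ((k : ℂ) + 1))
          * ((lam + α + 1) / (α + 1)) * omegaMaya M₁ M₂ (α + 1) lam x := by
  -- The final 1 accounts for the minus sign in -(λ + α + 1)/(α + 1).
  refine ⟨M₁.right.length + M₂.right.length + M₁.right.length + 1,
    fun {α} lam hα {x} hx => ?_⟩
  unfold omegaMaya
  rw [right_shift_of_mem h, omegaFirst_expLaguerre_zero _ _ _ _ lam hx hα, ← left_of_mem h,
    prod_map_left, prod_map_left, pow_succ]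
  ring

theorem omegaMaya_right_of_notMem {M₂ : MayaDiagram} (h : (-1 : ℤ) ∉ M₂.carrier)
    (M₁ : MayaDiagram) : ∃ d : ℕ, ∀ {α : ℝ} (lam : ℂ), (∀ k : ℕ, α + 1 ≠ -(k : ℝ)) →
      (∀ k : ℕ, α ≠ -(k : ℝ)) → ∀ {x : ℝ}, 0 < x → omegaMaya M₁ M₂ α lam x =
        (-1) ^ d * ((∏ k ∈ M₂.rightSet, ((k : ℂ) + 1)) * ∏ k ∈ M₁.rightSet, ((k : ℂ) + α))
          * α * omegaMaya M₁ (M₂.shift 1) (α - 1) lam x := by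
  refine ⟨M₁.right.length + M₂.right.length + (M₂.shift 1).left.length
    + (M₂.shift 1).left.length, fun {α} lam hα hα' {x} hx => ?_⟩
  unfold omegaMaya
  rw [left_of_notMem h, omegaFirst_powLaguerre_zero _ _ _ _ lam hx hα hα',
    ← right_shift_of_notMem h, prod_map_right, prod_map_right, mul_assoc ((-1) ^ _),
    mul_comm (∏ k ∈ M₁.rightSet, _)]

/-! ### Induction on the shifts -/

/-- The shift formula for a pair of Maya diagrams. -/
def OmegaShiftFormula (M₁ M₂ : MayaDiagram) (t₁ t₂ : ℤ) : Prop :=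
  ∃ d : ℕ, ∀ (α : ℝ) (lam : ℂ), (∀ k : ℕ, α + 1 ≠ -(k : ℝ)) →
    (∀ k : ℕ, α - t₁ - t₂ + 1 ≠ -(k : ℝ)) →
    (0 < t₁ → ∀ k < t₁.natAbs, k ∉ M₁.leftSet → -lam - (k : ℂ) - 1 ≠ 0) →
    (0 < t₂ → ∀ k < t₂.natAbs, k ∉ M₂.leftSet → lam + (α : ℂ) - (k : ℂ) ≠ 0) →
    (t₂ < 0 → ∀ k < t₂.natAbs, α - t₁ + 1 + (k : ℝ) ≠ 0) →
    ∀ x : ℝ, 0 < x →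
      omegaMaya M₁ M₂ α lam x =
        (-1) ^ d * constC₁ α lam M₁ t₁ * constC₂ α lam M₂ t₁ t₂ * constC₃ α M₁ M₂ *
          omegaPartition (M₁.shift t₁).partition (M₂.shift t₂).partition
            (α - t₁ - t₂) (lam + t₁) x

theorem neg_one_pow_mul_self (n : ℕ) : (-1 : ℂ) ^ n * (-1) ^ n = 1 := by
  rw [← mul_pow]; simp

/-- Inverts a one-step relation: Ω' belongs to the shifted diagram, where the formula is known, and
P is the factor common to the relation and to the recursion of C₃. -/
theorem eq_of_mul_eq {Ω Ω' P k C C' W : ℂ} {d e : ℕ} (hP : P ≠ 0) (hk : k ≠ 0)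
    (h : Ω' = (-1) ^ e * P * k * Ω) (h' : Ω' = (-1) ^ d * C * (C' * P) * W) :
    Ω = (-1) ^ (d + e) * (k⁻¹ * C) * C' * W := by
  have he : (-1 : ℂ) ^ e ≠ 0 := pow_ne_zero _ (by norm_num)
  apply mul_left_cancel₀ (mul_ne_zero (mul_ne_zero he hP) hk)
  rw [← h, h', pow_add]
  field_simp
  rw [← pow_mul, mul_comm e, pow_mul, neg_one_sq, one_pow, mul_one]

theorem omegaShiftFormula_zero_zero {M₁ M₂ : MayaDiagram} (h₁ : M₁.IsCanonical)
    (h₂ : M₂.IsCanonical) : OmegaShiftFormula M₁ M₂ 0 0 := by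
  refine ⟨0, fun α lam _ _ _ _ _ x _ => ?_⟩
  simp [omegaMaya_of_isCanonical h₁ h₂, constC₁, constC₂, constC₃_of_isCanonical h₁ h₂, shift_zero]

theorem omegaShiftFormula_zero_natCast {M₁ : MayaDiagram} (h₁ : M₁.IsCanonical) (t : ℕ) :
    ∀ M₂ : MayaDiagram, (M₂.shift t).IsCanonical → OmegaShiftFormula M₁ M₂ 0 t := by
  induction t with
  | zero =>
    intro M₂ h₂
    exact omegaShiftFormula_zero_zero h₁ (by rwa [Nat.cast_zero, shift_zero] at h₂)
  | succ t ih =>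
    intro M₂ h₂
    rw [Nat.cast_succ] at h₂ ⊢
    have hcan := isCanonical_shift_one_shift h₂
    obtain ⟨d, hd⟩ := ih _ hcan
    have key : ∀ (α : ℝ) (lam : ℂ), (∀ k : ℕ, α - (0 : ℤ) - (t + 1 : ℤ) + 1 ≠ -(k : ℝ)) →
        (0 < (t + 1 : ℤ) → ∀ k < (t + 1 : ℤ).natAbs, k ∉ M₂.leftSet →
          lam + (α : ℂ) - (k : ℂ) ≠ 0) → (∀ k : ℕ, α ≠ -(k : ℝ)) ∧ ∀ x : ℝ, 0 < x →
        omegaMaya M₁ (M₂.shift 1) (α - 1) lam x = (-1) ^ d * constC₂ (α - 1) lam (M₂.shift 1) 0 t *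
          constC₃ (α - 1) M₁ (M₂.shift 1) * omegaPartition (M₁.shift 0).partition
            (M₂.shift (t + 1)).partition (α - (0 : ℤ) - (t + 1 : ℤ)) (lam + (0 : ℤ)) x := by
      intro α lam H2 H5
      -- If α = -k, the final parameter plus one would be -(k + t).
      have hα : ∀ k : ℕ, α ≠ -(k : ℝ) := fun k hk => H2 (k + t) (by push_cast; linarith)
      refine ⟨hα, fun x hx => ?_⟩
      have := hd (α - 1) lam (by simpa using hα)
        (fun k hk => H2 k (by push_cast at hk ⊢; linarith)) (fun h => absurd h (lt_irrefl 0))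
        (fun _ k hk hkl h => H5 (by omega) (k + 1) (by omega)
          (fun hh => hkl (mem_leftSet_shift.2 hh)) (by push_cast at h ⊢; linear_combination h))
        (fun h => by omega) x hx
      rw [this, shift_shift, add_comm (1 : ℤ), constC₁, if_neg (lt_irrefl 0), if_pos rfl, mul_one]
      push_cast
      rw [show α - 1 - 0 - (t : ℝ) = α - 0 - (t + 1) by ring]
    by_cases h : (-1 : ℤ) ∈ M₂.carrier
    · obtain ⟨e, he⟩ := omegaMaya_shift_right_of_mem h M₁
      refine ⟨d + e, fun α lam H1 H2 _ H5 _ x hx => ?_⟩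
      obtain ⟨hα, hk⟩ := key α lam H2 H5
      have hk := hk x hx
      have h0 := he (α := α - 1) lam (by simpa using hα) hx
      have hα0 : (α : ℂ) ≠ 0 := by simpa using complex_ne_neg_natCast hα 0
      have hl0 : lam + α ≠ 0 := by
        have := H5 (by omega) 0 (by omega) (by simpa [zero_mem_leftSet] using h)
        simpa using this
      have hP : ∏ k ∈ (M₂.shift 1).leftSet, ((k : ℂ) + 1) ≠ 0 :=
        Finset.prod_ne_zero_iff.2 fun k _ => by exact_mod_cast Nat.succ_ne_zero k
      have h3 := constC₃_shift_of_mem h M₁ (α - 1)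
      -- M₁ is canonical, so the product over its left entries is empty and the divisor P keeps only
      -- factors k + 1.
      rw [constC₃_swap, h3, leftSet_eq_empty h₁, sub_add_cancel, constC₃_swap] at hk
      rw [leftSet_eq_empty h₁, sub_add_cancel] at h0
      simp only [Finset.prod_empty, one_mul] at h0 hk
      push_cast at h0
      rw [sub_add_cancel, add_assoc, sub_add_cancel] at h0
      rw [eq_of_mul_eq hP (div_ne_zero hl0 hα0) h0 hk, constC₂_natCast_add_one_of_mem h _ _ h₂,
        constC₁, if_neg (lt_irrefl 0), if_pos rfl, inv_div, mul_one]
    · obtain ⟨e, he⟩ := omegaMaya_right_of_notMem h M₁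
      -- The cardinality cancels the sign in `constC₃_of_notMem`.
      refine ⟨d + e + M₁.rightSet.card, fun α lam H1 H2 _ H5 _ x hx => ?_⟩
      obtain ⟨hα, hk⟩ := key α lam H2 H5
      have es := neg_one_pow_mul_self M₁.rightSet.card
      rw [he lam H1 hα hx, hk x hx, constC₃_swap α, constC₃_of_notMem h M₁,
        constC₃_swap _ (M₂.shift 1), constC₂_natCast_add_one_of_notMem h _ _ h₂, constC₁,
        if_neg (lt_irrefl 0), if_pos rfl]
      rw [pow_add, pow_add]
      generalize (-1 : ℂ) ^ M₁.rightSet.card = s at es ⊢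
      generalize ∏ k ∈ M₂.rightSet, ((k : ℂ) + 1) = p
      generalize ∏ k ∈ M₁.rightSet, ((k : ℂ) + α) = q
      generalize omegaPartition _ _ _ _ _ = w
      linear_combination (-(-1) ^ d * (-1) ^ e * p * q * α * constC₂ (α - 1) lam (M₂.shift 1) 0 t *
        constC₃ (α - 1) M₁ (M₂.shift 1) * w) * es

/-- With t < 0 the box 0 is filled, so a right entry 0 can be removed; negative shifts therefore
never meet the empty case and never need an inversion. -/
theorem exists_shift_one_eq {M : MayaDiagram} {t : ℤ} (h : (M.shift t).IsCanonical) (ht : t < 0) :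
    ∃ N : MayaDiagram, N.shift 1 = M ∧ (-1 : ℤ) ∈ N.carrier := by
  refine ⟨M.shift (-1), by rw [shift_shift, neg_add_cancel, shift_zero], ?_⟩
  simpa [mem_shift] using zero_mem_of_isCanonical_shift_neg h ht

theorem omegaShiftFormula_zero_neg_natCast {M₁ : MayaDiagram} (h₁ : M₁.IsCanonical) (t : ℕ) :
    ∀ M₂ : MayaDiagram, (M₂.shift (-t)).IsCanonical → OmegaShiftFormula M₁ M₂ 0 (-t) := by
  induction t with
  | zero =>
    intro M₂ h₂
    rw [Nat.cast_zero, neg_zero] at h₂ ⊢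
    exact omegaShiftFormula_zero_zero h₁ (by rwa [shift_zero] at h₂)
  | succ t ih =>
    intro M h₂
    obtain ⟨M₂, rfl, h⟩ := exists_shift_one_eq h₂ (by omega)
    rw [Nat.cast_succ, neg_add'] at h₂ ⊢
    rw [shift_shift, add_sub_cancel] at h₂
    obtain ⟨d, hd⟩ := ih _ h₂
    obtain ⟨e, he⟩ := omegaMaya_shift_right_of_mem h M₁
    refine ⟨d + e, fun α lam H1 H2 _ _ _ x hx => ?_⟩
    have hα : ∀ k : ℕ, α + 1 + 1 ≠ -(k : ℝ) := fun k hk => H1 (k + 1) (by push_cast; linarith)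
    have hk := hd (α + 1) lam hα (fun k hk => H2 k (by push_cast at hk ⊢; linarith))
      (fun h => absurd h (lt_irrefl 0)) (fun h => by omega)
      (fun _ k _ hk => H1 (k + 1) (by push_cast at hk ⊢; linarith)) x hx
    rw [he lam H1 hx, hk, shift_shift, add_sub_cancel, constC₃_swap α, constC₃_shift_of_mem h M₁,
      constC₃_swap (α + 1), constC₂_neg_natCast_sub_one _ _ _ M₂, constC₁, constC₁,
      if_neg (lt_irrefl 0), if_pos rfl, if_neg (lt_irrefl 0), if_pos rfl]
    push_cast
    rw [show α + 1 - 0 - -(t : ℝ) = α - 0 - (-t - 1) by ring]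
    ring

theorem omegaShiftFormula_zero_left {M₁ M₂ : MayaDiagram} {t : ℤ} (h₁ : M₁.IsCanonical)
    (h₂ : (M₂.shift t).IsCanonical) : OmegaShiftFormula M₁ M₂ 0 t := by
  obtain ⟨n, rfl | rfl⟩ := t.eq_nat_or_neg
  · exact omegaShiftFormula_zero_natCast h₁ n M₂ h₂
  · exact omegaShiftFormula_zero_neg_natCast h₁ n M₂ h₂

theorem omegaShiftFormula_natCast {M₂ : MayaDiagram} {t₂ : ℤ} (h₂ : (M₂.shift t₂).IsCanonical)
    (t : ℕ) : ∀ M₁ : MayaDiagram, (M₁.shift t).IsCanonical → OmegaShiftFormula M₁ M₂ t t₂ := by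
  induction t with
  | zero =>
    intro M₁ h₁
    exact omegaShiftFormula_zero_left (by rwa [Nat.cast_zero, shift_zero] at h₁) h₂
  | succ t ih =>
    intro M₁ h₁
    rw [Nat.cast_succ] at h₁ ⊢
    obtain ⟨d, hd⟩ := ih _ (isCanonical_shift_one_shift h₁)
    have key : ∀ (α : ℝ) (lam : ℂ), (∀ k : ℕ, α - (t + 1 : ℤ) - t₂ + 1 ≠ -(k : ℝ)) →
        (0 < (t + 1 : ℤ) → ∀ k < (t + 1 : ℤ).natAbs, k ∉ M₁.leftSet → -lam - (k : ℂ) - 1 ≠ 0) →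
        (0 < t₂ → ∀ k < t₂.natAbs, k ∉ M₂.leftSet → lam + (α : ℂ) - (k : ℂ) ≠ 0) →
        (t₂ < 0 → ∀ k < t₂.natAbs, α - (t + 1 : ℤ) + 1 + (k : ℝ) ≠ 0) →
        (∀ k : ℕ, α ≠ -(k : ℝ)) ∧ ∀ x : ℝ, 0 < x →
        omegaMaya (M₁.shift 1) M₂ (α - 1) (lam + 1) x =
          (-1) ^ d * (constC₁ (α - 1) (lam + 1) (M₁.shift 1) t * constC₂ α lam M₂ (t + 1) t₂) *
          constC₃ (α - 1) (M₁.shift 1) M₂ * omegaPartition (M₁.shift (t + 1)).partition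
            (M₂.shift t₂).partition (α - (t + 1 : ℤ) - t₂) (lam + (t + 1 : ℤ)) x := by
      intro α lam H2 H4 H5 H6
      have hα : ∀ k : ℕ, α ≠ -(k : ℝ) := by
        intro k hk
        -- If k + t + t₂ ≥ 0, the final parameter excludes α = -k; otherwise t₂ < 0 and k + t <
        -- |t₂|, and a denominator of C₂ would vanish.
        by_cases hkt : 0 ≤ k + t + t₂
        · obtain ⟨j, hj⟩ := Int.eq_ofNat_of_zero_le hkt
          have hj' : (k : ℝ) + t + t₂ = j := by exact_mod_cast hj
          exact H2 j (by push_cast; linarith)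
        · exact H6 (by omega) (k + t) (by omega) (by push_cast; linarith)
      refine ⟨hα, fun x hx => ?_⟩
      have := hd (α - 1) (lam + 1) (by simpa using hα)
        (fun k hk => H2 k (by push_cast at hk ⊢; linarith))
        (fun _ k hk hkl h => H4 (by omega) (k + 1) (by omega)
          (fun hh => hkl (mem_leftSet_shift.2 hh)) (by push_cast at h ⊢; linear_combination h))
        (fun h k hk hkl hh => H5 h k hk hkl (by push_cast at hh; linear_combination hh))
        (fun h k hk hh => H6 h k hk (by push_cast at hh ⊢; linarith)) x hx
      rw [this, shift_shift, add_comm (1 : ℤ), constC₂_add_one]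
      push_cast
      rw [show α - 1 - (t : ℝ) - t₂ = α - (t + 1) - t₂ by ring,
        show lam + 1 + (t : ℂ) = lam + (t + 1) by ring]
      ring
    by_cases h : (-1 : ℤ) ∈ M₁.carrier
    · refine ⟨d + 0, fun α lam H1 H2 H4 H5 H6 x hx => ?_⟩
      obtain ⟨hα, hk⟩ := key α lam H2 H4 H5 H6
      have hk := hk x hx
      have h0 := omegaMaya_shift_left_of_mem h M₂ (α := α - 1) (lam + 1) (by simpa using hα) hx
      have hα0 : (α : ℂ) ≠ 0 := by simpa using complex_ne_neg_natCast hα 0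
      have hl0 : -lam - 1 ≠ 0 := by
        have := H4 (by omega) 0 (by omega) (by simpa [zero_mem_leftSet] using h)
        simpa using this
      have hP : (∏ k ∈ M₂.leftSet, ((k : ℂ) - ((α - 1 : ℝ) : ℂ))) *
          ∏ k ∈ (M₁.shift 1).leftSet, ((k : ℂ) + 1) ≠ 0 := by
        refine mul_ne_zero (Finset.prod_ne_zero_iff.2 fun k hk hh => ?_)
          (Finset.prod_ne_zero_iff.2 fun k _ => by exact_mod_cast Nat.succ_ne_zero k)
        have hk' : (k : ℝ) - (α - 1) = 0 := by exact_mod_cast hh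
        -- Left entries of M₂ satisfy k < t₂, so α = k + 1 would make the final parameter plus one
        -- equal to -(t + t₂ - k - 1), a non-positive integer.
        obtain ⟨j, hj⟩ := Int.eq_ofNat_of_zero_le (a := t + t₂ - k - 1)
          (by have := lt_of_mem_leftSet h₂ hk; omega)
        have hj' : (t : ℝ) + t₂ - k - 1 = j := by exact_mod_cast hj
        exact H2 j (by push_cast; linarith)
      have hcast : ((α - 1 : ℝ) : ℂ) + 1 = α := by push_cast; ring
      rw [constC₃_shift_of_mem h, sub_add_cancel] at hk
      rw [hcast, sub_add_cancel, add_sub_cancel_right, neg_add'] at h0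
      have h0' := eq_of_mul_eq (e := 0) hP (div_ne_zero hl0 hα0)
        (by rw [h0, pow_zero, one_mul]) hk
      rw [h0', constC₁_natCast_add_one_of_mem h, inv_div]
      ring
    · obtain ⟨e, he⟩ := omegaMaya_left_of_notMem h M₂
      refine ⟨d + e + M₂.rightSet.card, fun α lam H1 H2 H4 H5 H6 x hx => ?_⟩
      obtain ⟨hα, hk⟩ := key α lam H2 H4 H5 H6
      have es := neg_one_pow_mul_self M₂.rightSet.card
      rw [he lam H1 hα hx, hk x hx, constC₃_of_notMem h M₂, constC₁_natCast_add_one_of_notMem h]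
      rw [pow_add, pow_add]
      generalize (-1 : ℂ) ^ M₂.rightSet.card = s at es ⊢
      generalize ∏ k ∈ M₁.rightSet, ((k : ℂ) + 1) = p
      generalize ∏ k ∈ M₂.rightSet, ((k : ℂ) + α) = q
      generalize omegaPartition _ _ _ _ _ = w
      linear_combination (-(-1) ^ d * (-1) ^ e * p * q * α *
        constC₁ (α - 1) (lam + 1) (M₁.shift 1) t * constC₂ α lam M₂ (t + 1) t₂ *
        constC₃ (α - 1) (M₁.shift 1) M₂ * w) * es

theorem omegaShiftFormula_neg_natCast {M₂ : MayaDiagram} {t₂ : ℤ} (h₂ : (M₂.shift t₂).IsCanonical)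
    (t : ℕ) : ∀ M₁ : MayaDiagram, (M₁.shift (-t)).IsCanonical →
      OmegaShiftFormula M₁ M₂ (-t) t₂ := by
  induction t with
  | zero =>
    intro M₁ h₁
    rw [Nat.cast_zero, neg_zero] at h₁ ⊢
    exact omegaShiftFormula_zero_left (by rwa [shift_zero] at h₁) h₂
  | succ t ih =>
    intro M h₁
    obtain ⟨M₁, rfl, h⟩ := exists_shift_one_eq h₁ (by omega)
    rw [Nat.cast_succ, neg_add'] at h₁ ⊢
    rw [shift_shift, add_sub_cancel] at h₁
    obtain ⟨d, hd⟩ := ih _ h₁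
    refine ⟨d, fun α lam H1 H2 _ H5 H6 x hx => ?_⟩
    have hα : ∀ k : ℕ, α + 1 + 1 ≠ -(k : ℝ) := fun k hk => H1 (k + 1) (by push_cast; linarith)
    have hk := hd (α + 1) (lam - 1) hα (fun k hk => H2 k (by push_cast at hk ⊢; linarith))
      (fun h => by omega)
      (fun h k hk hkl hh => H5 h k hk hkl (by push_cast at hh; linear_combination hh))
      (fun h k hk hh => H6 h k hk (by push_cast at hh ⊢; linarith)) x hx
    have hC₂ : constC₂ (α + 1) (lam - 1) M₂ (-t) t₂ = constC₂ α lam M₂ (-t - 1) t₂ := by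
      have := constC₂_add_one (α + 1) (lam - 1) M₂ (-t - 1) t₂
      rwa [sub_add_cancel, sub_add_cancel, add_sub_cancel_right] at this
    rw [omegaMaya_shift_left_of_mem h M₂ lam H1 hx, hk, shift_shift, add_sub_cancel,
      constC₃_shift_of_mem h M₂, constC₁_neg_natCast_sub_one _ _ _ M₁, hC₂]
    push_cast
    rw [show α + 1 - -(t : ℝ) - t₂ = α - (-t - 1) - t₂ by ring,
      show lam - 1 + -(t : ℂ) = lam + (-t - 1) by ring]
    ring

theorem omegaShiftFormula_of_isCanonical {M₁ M₂ : MayaDiagram} {t₁ t₂ : ℤ}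
    (h₁ : (M₁.shift t₁).IsCanonical) (h₂ : (M₂.shift t₂).IsCanonical) :
    OmegaShiftFormula M₁ M₂ t₁ t₂ := by
  obtain ⟨n, rfl | rfl⟩ := t₁.eq_nat_or_neg
  · exact omegaShiftFormula_natCast h₂ n M₁ h₁
  · exact omegaShiftFormula_neg_natCast h₂ n M₁ h₁

theorem mainTheorem2 (M₁ M₂ : MayaDiagram) (t₁ t₂ : ℤ)
    (ht₁ : (M₁.shift t₁).IsCanonical) (ht₂ : (M₂.shift t₂).IsCanonical) :
    ∃ d : ℕ, ∀ (α : ℝ) (lam : ℂ),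
      -- the functions `h` on both sides are defined
      (∀ k : ℕ, α + 1 ≠ -(k : ℝ)) →
      (∀ k : ℕ, α - t₁ - t₂ + 1 ≠ -(k : ℝ)) →
      -- the spectral parameter avoids the indices `n_i`
      (∀ n ∈ M₁.right, lam ≠ (n : ℂ)) →
      -- the denominators of the constants do not vanish
      (0 < t₁ → ∀ k < t₁.natAbs, k ∉ M₁.left → -lam - (k : ℂ) - 1 ≠ 0) →
      (0 < t₂ → ∀ k < t₂.natAbs, k ∉ M₂.left → lam + (α : ℂ) - (k : ℂ) ≠ 0) →
      (t₂ < 0 → ∀ k < t₂.natAbs, α - t₁ + 1 + (k : ℝ) ≠ 0) →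
      ∀ x : ℝ, 0 < x →
        omegaMaya M₁ M₂ α lam x =
          (-1) ^ d * constC₁ α lam M₁ t₁ * constC₂ α lam M₂ t₁ t₂ * constC₃ α M₁ M₂ *
            omegaPartition (M₁.shift t₁).partition (M₂.shift t₂).partition
              (α - t₁ - t₂) (lam + t₁) x := by
  obtain ⟨d, hd⟩ := omegaShiftFormula_of_isCanonical ht₁ ht₂
  refine ⟨d, fun α lam H1 H2 _ H4 H5 H6 x hx => hd α lam H1 H2 (fun h k hk hkl => H4 h k hk ?_)
    (fun h k hk hkl => H5 h k hk ?_) H6 x hx⟩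
  · rwa [mem_left]
  · rwa [mem_left]
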